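/- **Setting.** Let $n\ge 1$, $k\in\{1,n\}$, let $\Omega\subset\mathbb R^n$ be open with $0\in\Omega$, and let $f,g:\Omega\to\mathbb R^n$ be smooth with $f(0)=g(0)=0$. Consider the hyperbolically regularized conservation law $g(v)_t+f(v)_x=v_{xx}-v_{tt}$ and assume: * (A1) $Df(v)$ and $Dg(v)$ are symmetric for all $v\in\Omega$, and $Dg(0)$ is positive definite; * (A2) $Df(0)$ has $n$ real, simple eigenvalues with respect to $Dg(0)$; for $v$ near $0$, $\mu_1(v)<\dots<\mu_n(v)$ denote the eigenvalues of $Df(v)$ with respect to $Dg(v)$, i.e. $Df(v)r=\mu_j(v)Dg(v)r$ for some $r\neq0$; * (A3) $\mu_k$ is genuinely nonlinear at $0$, i.e. $D\mu_k(0)r\neq0$ for an eigenvector $r$ belonging to $\mu_k(0)$; * (A4) $Dg(0)\pm Df(0)$ are positive definite. The coordinates are chosen such that $Df(0)-\mu_k(0)Dg(0)=\operatorname{diag}(\lambda_1,\dots,\lambda_n)$ with $\lambda_k=0$ and $\lambda_j<0<\lambda_{j'}$ for $j<k<j'$, and such that $D\mu_k(0)e_k<0$. Let $\varepsilon_1\in(0,1]$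 and let $(v^-_\varepsilon,v^+_\varepsilon,s(\varepsilon))_{\varepsilon\in[0,\varepsilon_1]}$ be a smooth family such that * (i) for $\varepsilon>0$ it is a Lax $k$-shock: $v^\pm_\varepsilon\in\Omega$, $f(v^+_\varepsilon)-f(v^-_\varepsilon)=s(\varepsilon)(g(v^+_\varepsilon)-g(v^-_\varepsilon))$, $\mu_k(v^+_\varepsilon)<s(\varepsilon)<\mu_k(v^-_\varepsilon)$, and $(\mu_j(v^-_\varepsilon)-s(\varepsilon))(\mu_j(v^+_\varepsilon)-s(\varepsilon))>0$ for $j\ne k$; * (ii) $s(0)=\mu_k(0)$ and $s'(0)=0$; * (iii) $v^\pm_\varepsilon=\pm\varepsilon(e_k+\mathcal O(\varepsilon))$ and $(v^\pm_\varepsilon)_k=\pm\varepsilon$; * (iv) for $\varepsilon>0$, $v^-_\varepsilon$ and $v^+_\varepsilon$ are the only solutions $v\in\Omega$, $|v|<3\varepsilon$, of $f(v)-s(\varepsilon)g(v)=f(v^-_\varepsilon)-s(\varepsilon)g(v^-_\varepsilon)$. Put $\gamma_\varepsilon=(1-s(\varepsilon)^2)^{-1/2}$, $f_\varepsilon=\gamma_\varepsilon(f-s(\varepsilon)g)$,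 $g_\varepsilon=\gamma_\varepsilon(g-s(\varepsilon)f)$. A shock profile is a smooth $\phi_\varepsilon:\mathbb R\to\Omega$ with $\phi_\varepsilon'=f_\varepsilon(\phi_\varepsilon)-f_\varepsilon(v^-_\varepsilon)$ and $\phi_\varepsilon(\pm\infty)=v^\pm_\varepsilon$; we consider shock profiles of small amplitude, $|\phi_\varepsilon(x)|\le3\varepsilon$ for all $x\in\mathbb R$. For $\kappa\in\mathbb C$ let $\mathcal H^\pm_\varepsilon(\kappa)\subset\mathbb C^{2n}$ be the space of all values $\xi(0)$ of solutions $\xi:\mathbb R\to\mathbb C^{2n}$ of the Laplace-mode system $$\xi'=\begin{pmatrix}Df_\varepsilon(\phi_\varepsilon)&\mathbb 1_n\\ \kappa^2\mathbb 1_n+\kappa Dg_\varepsilon(\phi_\varepsilon)&0\end{pmatrix}\xi$$ that tend to $0$ at $\pm\infty$ (the fibres of the Evans bundles), and let $H^\pm_\varepsilon(\zeta)=\mathcal H^\pm_\varepsilon(\varepsilon^2\zeta)$ be the rescaled Evans bundles. **Lemma (outmost regime).** For any $r_1>0$ there exists $\varepsilon_0=\varepsilon_0(r_1)\in(0,\varepsilon_1]$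 such that for all $\varepsilon\in(0,\varepsilon_0]$, all such profiles $\phi_\varepsilon$, and all $\zeta\in\mathbb C$ with $\operatorname{Re}\zeta\ge0$ and $r_1\le\varepsilon^2|\zeta|$, the spaces $H^-_\varepsilon(\zeta)$ and $H^+_\varepsilon(\zeta)$ are both $n$-dimensional and are transversal: $$H^-_\varepsilon(\zeta)\cap H^+_\varepsilon(\zeta)=\{0\}.$$ -/

import Mathlib

open Set Filter Topology
open scoped ContDiff Matrix

noncomputable section

namespace HypReg

/-- The state space `ℝⁿ` with its Euclidean norm. -/
abbrev Sp (n : ℕ) := EuclideanSpace ℝ (Fin n)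

/-- The phase space `ℂ²ⁿ` of the first-order Laplace-mode system, `ξ = (p, q)`. -/
abbrev Ph (n : ℕ) := (Fin n ⊕ Fin n) → ℂ

/-- The `j`-th standard unit vector of `ℝⁿ`. -/
def unitVec {n : ℕ} (j : Fin n) : Sp n := EuclideanSpace.single j 1

/-- The Jacobian matrix of `f` at `v`. -/
def jac {n : ℕ} (f : Sp n → Sp n) (v : Sp n) : Matrix (Fin n) (Fin n) ℝ :=
  Matrix.of fun i j => (fderiv ℝ f v (unitVec j)) i

/-- `μ₁ < ⋯ < μₙ` are real eigenvalues of `F` with respect to `G`: `F r = μⱼ G r`, `r ≠ 0`.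
Since there are `n` of them, all eigenvalues are then real and simple. -/
def IsOrderedSpectrum {n : ℕ} (F G : Matrix (Fin n) (Fin n) ℝ) (μ : Fin n → ℝ) : Prop :=
  StrictMono μ ∧ ∀ j, ∃ r : Fin n → ℝ, r ≠ 0 ∧ F *ᵥ r = μ j • (G *ᵥ r)

open Classical in
/-- The eigenvalues of `F` with respect to `G` in increasing order, when they are real and simple
(for positive definite `G` they are then uniquely determined). -/
def genEig {n : ℕ} (F G : Matrix (Fin n) (Fin n) ℝ) : Fin n → ℝ :=
  if h : ∃ μ, IsOrderedSpectrum F G μ then h.choose else 0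

/-- The characteristic speed `μⱼ(v)`: the `j`-th eigenvalue of `Df(v)` with respect to `Dg(v)`. -/
def charSpeed {n : ℕ} (f g : Sp n → Sp n) (j : Fin n) (v : Sp n) : ℝ :=
  genEig (jac f v) (jac g v) j

/-- The standing assumptions A1 - A4 on `g(v)_t + f(v)_x = v_xx - v_tt` at the reference
state `0`. -/
structure StandingAssumptions {n : ℕ} (k : Fin n) (Ω : Set (Sp n)) (f g : Sp n → Sp n) :
    Prop where
  symm_f : ∀ v ∈ Ω, (jac f v).IsSymm
  symm_g : ∀ v ∈ Ω, (jac g v).IsSymm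
  posDef_g : (jac g 0).PosDef
  simple : ∃ μ, IsOrderedSpectrum (jac f 0) (jac g 0) μ
  /-- genuine nonlinearity of the `k`-th characteristic speed at `0` -/
  gnl : ∃ r : Sp n, r ≠ 0 ∧
    jac f 0 *ᵥ r.ofLp = charSpeed f g k 0 • (jac g 0 *ᵥ r.ofLp) ∧
    fderiv ℝ (charSpeed f g k) 0 r ≠ 0
  subchar_add : (jac g 0 + jac f 0).PosDef
  subchar_sub : (jac g 0 - jac f 0).PosDef

/-- The normalization of the coordinates: `f(0) = g(0) = 0`, the matrix `Df(0) - μₖ(0) Dg(0)` is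
diagonal with the stated signs (so that `eₖ` spans the `k`-th eigendirection), and `eₖ` is oriented
such that `μₖ` decreases along it. -/
structure NormalCoordinates {n : ℕ} (k : Fin n) (f g : Sp n → Sp n) : Prop where
  f_zero : f 0 = 0
  g_zero : g 0 = 0
  diag : ∃ l : Fin n → ℝ,
    jac f 0 - charSpeed f g k 0 • jac g 0 = Matrix.diagonal l ∧
    l k = 0 ∧ (∀ j, j < k → l j < 0) ∧ (∀ j, k < j → 0 < l j)
  orient : fderiv ℝ (charSpeed f g k) 0 (unitVec k) < 0

/-- `(v⁻, v⁺, s)` satisfies the Rankine-Hugoniot condition for `g(v)_t + f(v)_x = 0`. -/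
def IsShock {n : ℕ} (Ω : Set (Sp n)) (f g : Sp n → Sp n) (vm vp : Sp n) (s : ℝ) : Prop :=
  vm ∈ Ω ∧ vp ∈ Ω ∧ f vp - f vm = s • (g vp - g vm)

/-- `(v⁻, v⁺, s)` is a Lax `k`-shock. -/
def IsLaxShock {n : ℕ} (k : Fin n) (Ω : Set (Sp n)) (f g : Sp n → Sp n)
    (vm vp : Sp n) (s : ℝ) : Prop :=
  IsShock Ω f g vm vp s ∧
  charSpeed f g k vp < s ∧ s < charSpeed f g k vm ∧
  ∀ j, j ≠ k → 0 < (charSpeed f g j vm - s) * (charSpeed f g j vp - s)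

/-- The smooth families `(v⁻_ε, v⁺_ε, s(ε))`, `ε ∈ [0, ε₁]`, of small-amplitude `k`-shocks
with amplitude parameter `ε`. -/
structure IsShockFamily {n : ℕ} (k : Fin n) (Ω : Set (Sp n)) (f g : Sp n → Sp n) (ε₁ : ℝ)
    (vm vp : ℝ → Sp n) (s : ℝ → ℝ) : Prop where
  smooth_vm : ContDiffOn ℝ ∞ vm (Icc 0 ε₁)
  smooth_vp : ContDiffOn ℝ ∞ vp (Icc 0 ε₁)
  smooth_s : ContDiffOn ℝ ∞ s (Icc 0 ε₁)
  lax : ∀ ε ∈ Ioc 0 ε₁, IsLaxShock k Ω f g (vm ε) (vp ε) (s ε)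
  speed_zero : s 0 = charSpeed f g k 0
  deriv_speed_zero : derivWithin s (Icc 0 ε₁) 0 = 0
  /-- `v^±_ε = ± ε (eₖ + O(ε))` -/
  expansion : ∃ C : ℝ, ∀ ε ∈ Icc 0 ε₁,
    ‖vp ε - ε • unitVec k‖ ≤ C * ε ^ 2 ∧ ‖vm ε + ε • unitVec k‖ ≤ C * ε ^ 2
  component : ∀ ε ∈ Icc 0 ε₁, vp ε k = ε ∧ vm ε k = -ε
  /-- `v^±_ε` are the only states in the ball of radius `3ε` with the same relative flux -/
  only : ∀ ε ∈ Ioc 0 ε₁,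
    {v | v ∈ Ω ∩ Metric.ball 0 (3 * ε) ∧
      f v - s ε • g v = f (vm ε) - s ε • g (vm ε)} = {vm ε, vp ε}

/-- The Lorentz factor `γ(s) = (1 - s²)^(-1/2)`. -/
def gam (s : ℝ) : ℝ := (Real.sqrt (1 - s ^ 2))⁻¹

/-- The boosted flux `f_s = γ(s) (f - s g)`. -/
def boostF {n : ℕ} (f g : Sp n → Sp n) (s : ℝ) : Sp n → Sp n :=
  fun v => gam s • (f v - s • g v)

/-- The boosted density `g_s = γ(s) (g - s f)`. -/
def boostG {n : ℕ} (f g : Sp n → Sp n) (s : ℝ) : Sp n → Sp n :=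
  fun v => gam s • (g v - s • f v)

/-- `φ` is a shock profile for `(v⁻, v⁺, s)`:
`φ' = f_s(φ) - f_s(v⁻)`, `φ(±∞) = v^±`. -/
structure IsShockProfile {n : ℕ} (Ω : Set (Sp n)) (f g : Sp n → Sp n) (vm vp : Sp n) (s : ℝ)
    (φ : ℝ → Sp n) : Prop where
  smooth : ContDiff ℝ ∞ φ
  mem : ∀ x, φ x ∈ Ω
  ode : ∀ x, HasDerivAt φ (boostF f g s (φ x) - boostF f g s vm) x
  left : Tendsto φ atBot (𝓝 vm)
  right : Tendsto φ atTop (𝓝 vp)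

/-- The coefficient matrix
`[[Df_s(v), 1], [κ² 1 + κ Dg_s(v), 0]]` of the Laplace-mode system. -/
def modeMatrix {n : ℕ} (f g : Sp n → Sp n) (s : ℝ) (κ : ℂ) (v : Sp n) :
    Matrix (Fin n ⊕ Fin n) (Fin n ⊕ Fin n) ℂ :=
  Matrix.fromBlocks ((jac (boostF f g s) v).map Complex.ofReal) 1
    (κ ^ 2 • (1 : Matrix (Fin n) (Fin n) ℂ) + κ • (jac (boostG f g s) v).map Complex.ofReal) 0

/-- `ξ` solves the Laplace-mode system along `φ` on the whole line. -/
def IsModeSolution {n : ℕ} (f g : Sp n → Sp n) (s : ℝ) (κ : ℂ) (φ : ℝ → Sp n)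
    (ξ : ℝ → Ph n) : Prop :=
  ∀ x, HasDerivAt ξ (modeMatrix f g s κ (φ x) *ᵥ ξ x) x

/-- The initial values at `x = 0` of the solutions of the Laplace-mode system that tend to zero
along the filter `l`. -/
def decaySpace {n : ℕ} (f g : Sp n → Sp n) (s : ℝ) (κ : ℂ) (φ : ℝ → Sp n) (l : Filter ℝ) :
    Submodule ℂ (Ph n) where
  carrier := {ξ₀ | ∃ ξ, IsModeSolution f g s κ φ ξ ∧ ξ 0 = ξ₀ ∧ Tendsto ξ l (𝓝 0)}
  zero_mem' := by
    refine ⟨fun _ => 0, fun x => ?_, rfl, tendsto_const_nhds⟩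
    simpa using hasDerivAt_const x (0 : Ph n)
  add_mem' := by
    rintro a b ⟨ξ, h1, rfl, h3⟩ ⟨η, k1, rfl, k3⟩
    refine ⟨fun x => ξ x + η x, fun x => ?_, rfl, by simpa using h3.add k3⟩
    rw [Matrix.mulVec_add]
    exact (h1 x).add (k1 x)
  smul_mem' := by
    rintro c a ⟨ξ, h1, rfl, h3⟩
    refine ⟨fun x => c • ξ x, fun x => ?_, rfl, by simpa using h3.const_smul c⟩
    rw [Matrix.mulVec_smul]
    exact (h1 x).const_smul c

/-- The fibre `𝓗⁺(κ)` of the Evans bundle: initial values of the solutions decaying at `+∞`. -/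
def evansPlus {n : ℕ} (f g : Sp n → Sp n) (s : ℝ) (φ : ℝ → Sp n) (κ : ℂ) :
    Submodule ℂ (Ph n) := decaySpace f g s κ φ atTop

/-- The fibre `𝓗⁻(κ)` of the Evans bundle: initial values of the solutions decaying at `-∞`. -/
def evansMinus {n : ℕ} (f g : Sp n → Sp n) (s : ℝ) (φ : ℝ → Sp n) (κ : ℂ) :
    Submodule ℂ (Ph n) := decaySpace f g s κ φ atBot

/-- The rescaled Evans bundle `H⁺_ε(ζ) = 𝓗⁺_ε(ε² ζ)`. -/
def rescaledEvansPlus {n : ℕ} (f g : Sp n → Sp n) (s : ℝ) (φ : ℝ → Sp n) (ε : ℝ) (ζ : ℂ) :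
    Submodule ℂ (Ph n) := evansPlus f g s φ ((ε : ℂ) ^ 2 * ζ)

/-- The rescaled Evans bundle `H⁻_ε(ζ) = 𝓗⁻_ε(ε² ζ)`. -/
def rescaledEvansMinus {n : ℕ} (f g : Sp n → Sp n) (s : ℝ) (φ : ℝ → Sp n) (ε : ℝ) (ζ : ℂ) :
    Submodule ℂ (Ph n) := evansMinus f g s φ ((ε : ℂ) ^ 2 * ζ)

end HypReg

end

/-!
Write the Laplace-mode system for `ξ = (p, κ w)` as `p' = A p + κ w`, `w' = (κ + B) p`, where `A`
and `B` are the Jacobians of the boosted flux and density. At the reference state, `A + B` and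
`B - A` are positive definite; let `R` and `T` be their inverses. With `u = p + w`, `z = p - w` and
`σ = θ / κ̄` for a small constant `θ`, the form `⟪R u, u⟫ - ⟪T z, z⟫ + 2 Re ⟪σ w, p⟫` increases
strictly along solutions when `Re κ ≥ 0`: the first two terms control `p`, since
`⟪R u, (A + B) p⟫ + ⟪T z, (B - A) p⟫ = ⟪u + z, p⟫ = 2 ‖p‖²`, and the last one controls `w`. As `|κ|`
is bounded below, `σ` is bounded, so that the rate is uniform in `κ` and survives small
perturbations of `A` and `B`, in particular those caused by a profile of small amplitude.

The form is positive definite on the diagonal `w = p` and negative definite on the antidiagonal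
`w = -p`, both of the dimension of the state space. A strict Lyapunov form of this signature forces
the solutions decaying at `+∞`, and likewise those decaying at `-∞`, to form a space of half the
dimension; a solution decaying at both ends vanishes because the form is monotone along it.
-/

noncomputable section

namespace HypReg

section LinearODE

open BoundedContinuousFunction

variable {E : Type*} [NormedAddCommGroup E] [NormedSpace ℝ E] {M : ℝ → E →L[ℝ] E} {K : ℝ}

theorem integral_cosh_mul (c : ℝ) (x : ℝ) :
    ∫ t in (0 : ℝ)..x, Real.cosh (c * t) * c = Real.sinh (c * x) := by
  have hderiv (t : ℝ) : HasDerivAt (fun t => Real.sinh (c * t)) (Real.cosh (c * t) * c) t := by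
    simpa using ((hasDerivAt_id t).const_mul c).sinh
  rw [intervalIntegral.integral_eq_sub_of_hasDerivAt (fun t _ => hderiv t)
    (Continuous.intervalIntegrable (by fun_prop) _ _)]
  simp

theorem norm_integral_cosh_smul_le {c C : ℝ} {h : ℝ → E} (hC : ∀ t, ‖h t‖ ≤ c * C)
    (hC₀ : 0 ≤ C) (x : ℝ) :
    ‖∫ t in (0 : ℝ)..x, Real.cosh (c * t) • h t‖ ≤ Real.cosh (c * x) * C := by
  calc ‖∫ t in (0 : ℝ)..x, Real.cosh (c * t) • h t‖
      ≤ |∫ t in (0 : ℝ)..x, Real.cosh (c * t) * c * C| := by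
        refine intervalIntegral.norm_integral_le_abs_of_norm_le (Eventually.of_forall fun t => ?_)
          (Continuous.intervalIntegrable (by fun_prop) _ _)
        rw [norm_smul, Real.norm_of_nonneg (Real.cosh_pos _).le, mul_assoc]
        exact mul_le_mul_of_nonneg_left (hC t) (Real.cosh_pos _).le
    _ = Real.sinh |c * x| * C := by
        rw [intervalIntegral.integral_mul_const, integral_cosh_mul, abs_mul, abs_of_nonneg hC₀,
          Real.abs_sinh]
    _ ≤ Real.cosh (c * x) * C := by
        rw [← Real.cosh_abs (c * x)]
        exact mul_le_mul_of_nonneg_right (Real.sinh_lt_cosh _).le hC₀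

theorem continuous_cosh_smul_clm_apply (hM : Continuous M) (c : ℝ) (η : ℝ →ᵇ E) :
    Continuous fun t => Real.cosh (c * t) • M t (η t) :=
  Continuous.smul (by fun_prop) (hM.clm_apply η.continuous)

theorem norm_inv_cosh_smul_integral_le (hK : ∀ x, ‖M x‖ ≤ K) (η : ℝ →ᵇ E) (x : ℝ) :
    ‖(Real.cosh (2 * K * x))⁻¹ • ∫ t in (0 : ℝ)..x, Real.cosh (2 * K * t) • M t (η t)‖ ≤
      1 / 2 * ‖η‖ := by
  have hMη (t : ℝ) : ‖M t (η t)‖ ≤ 2 * K * (1 / 2 * ‖η‖) := by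
    calc ‖M t (η t)‖ ≤ K * ‖η‖ :=
          (M t).le_of_opNorm_le_of_le (hK t) (η.norm_coe_le_norm t)
      _ = 2 * K * (1 / 2 * ‖η‖) := by ring
  rw [norm_smul, norm_inv, Real.norm_of_nonneg (Real.cosh_pos _).le,
    inv_mul_le_iff₀ (Real.cosh_pos _)]
  exact norm_integral_cosh_smul_le hMη (by positivity) x

/-- The Volterra operator `ξ ↦ ∫₀ˣ M ξ` of the linear equation `ξ' = M(x) ξ` with `‖M‖ ≤ K`,
conjugated by the weight `cosh (2 K x)`. The weight grows fast enough to make it bounded on all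
of `ℝ`, with norm at most `1 / 2`. -/
def weightedVolterra (hM : Continuous M) (hK : ∀ x, ‖M x‖ ≤ K) :
    (ℝ →ᵇ E) →L[ℝ] (ℝ →ᵇ E) :=
  LinearMap.mkContinuous
    { toFun := fun η => ofNormedAddCommGroup
        (fun x => (Real.cosh (2 * K * x))⁻¹ •
          ∫ t in (0 : ℝ)..x, Real.cosh (2 * K * t) • M t (η t))
        (Continuous.smul
          (Continuous.inv₀ (by fun_prop) fun x => (Real.cosh_pos _).ne')
          (intervalIntegral.continuous_primitive
            (fun _ _ => (continuous_cosh_smul_clm_apply hM _ η).intervalIntegrable _ _) 0))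
        (1 / 2 * ‖η‖) (norm_inv_cosh_smul_integral_le hK η)
      map_add' := fun η θ => by
        ext x
        have hint (η : ℝ →ᵇ E) := (continuous_cosh_smul_clm_apply hM (2 * K) η).intervalIntegrable
          (μ := MeasureTheory.volume) 0 x
        simp [intervalIntegral.integral_add (hint η) (hint θ), smul_add]
      map_smul' := fun c η => by
        ext x
        simp [smul_comm _ c] }
    (1 / 2) fun η => (norm_le (by positivity)).2 (norm_inv_cosh_smul_integral_le hK η)

theorem weightedVolterra_apply (hM : Continuous M) (hK : ∀ x, ‖M x‖ ≤ K)
    (η : ℝ →ᵇ E) (x : ℝ) :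
    weightedVolterra hM hK η x =
      (Real.cosh (2 * K * x))⁻¹ • ∫ t in (0 : ℝ)..x, Real.cosh (2 * K * t) • M t (η t) :=
  rfl

theorem norm_weightedVolterra_lt_one (hM : Continuous M) (hK : ∀ x, ‖M x‖ ≤ K) :
    ‖weightedVolterra hM hK‖ < 1 :=
  (LinearMap.mkContinuous_norm_le _ (by norm_num) _).trans_lt (by norm_num)

theorem exists_boundedContinuousFunction_eq_add_weightedVolterra [CompleteSpace E]
    (hM : Continuous M) (hK : ∀ x, ‖M x‖ ≤ K) (b : ℝ →ᵇ E) :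
    ∃ η, η = b + weightedVolterra hM hK η := by
  let u := Units.oneSub _ (norm_weightedVolterra_lt_one hM hK)
  have hu : u.val * u⁻¹.val = 1 := u.mul_inv
  refine ⟨u⁻¹.val b, ?_⟩
  simpa [u, sub_eq_iff_eq_add] using DFunLike.congr_fun hu b

theorem exists_linearODE_solution [CompleteSpace E] (hM : Continuous M) (hK : ∀ x, ‖M x‖ ≤ K)
    (a : E) : ∃ ξ : ℝ → E, (∀ x, HasDerivAt ξ (M x (ξ x)) x) ∧ ξ 0 = a := by
  have hcosh (x : ℝ) : Real.cosh (2 * K * x) ≠ 0 := (Real.cosh_pos _).ne'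
  let b : ℝ →ᵇ E := ofNormedAddCommGroup (fun x => (Real.cosh (2 * K * x))⁻¹ • a)
    (Continuous.smul (Continuous.inv₀ (by fun_prop) hcosh) continuous_const) ‖a‖ fun x => by
      rw [norm_smul, norm_inv, Real.norm_of_nonneg (Real.cosh_pos _).le]
      exact mul_le_of_le_one_left (norm_nonneg _) (inv_le_one_of_one_le₀ (Real.one_le_cosh _))
  obtain ⟨η, hη⟩ := exists_boundedContinuousFunction_eq_add_weightedVolterra hM hK b
  have h_integral (x : ℝ) : Real.cosh (2 * K * x) • η x =
      a + ∫ t in (0 : ℝ)..x, Real.cosh (2 * K * t) • M t (η t) := by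
    have hηx : η x = b x + weightedVolterra hM hK η x := DFunLike.congr_fun hη x
    rw [hηx, weightedVolterra_apply, smul_add, smul_inv_smul₀ (hcosh x)]
    simp only [b, coe_ofNormedAddCommGroup, smul_inv_smul₀ (hcosh x)]
  refine ⟨fun x => a + ∫ t in (0 : ℝ)..x, Real.cosh (2 * K * t) • M t (η t), fun x => ?_, by simp⟩
  beta_reduce
  rw [← h_integral, map_smul]
  exact ((continuous_cosh_smul_clm_apply hM _ η).integral_hasStrictDerivAt
    0 x).hasDerivAt.const_add a

theorem exists_linearODE_solution_through [CompleteSpace E] (hM : Continuous M)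
    (hK : ∀ x, ‖M x‖ ≤ K) (x₀ : ℝ) (a : E) :
    ∃ ξ : ℝ → E, (∀ x, HasDerivAt ξ (M x (ξ x)) x) ∧ ξ x₀ = a := by
  obtain ⟨ξ, hξ, h₀⟩ := exists_linearODE_solution (M := fun x => M (x + x₀))
    (hM.comp (continuous_add_const x₀)) (fun x => hK _) a
  refine ⟨fun x => ξ (x - x₀), fun x => ?_, by simpa using h₀⟩
  simpa using (hξ (x - x₀)).comp_sub_const x x₀

theorem linearODE_solution_unique (hK : ∀ x, ‖M x‖ ≤ K) {ξ η : ℝ → E}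
    (hξ : ∀ x, HasDerivAt ξ (M x (ξ x)) x) (hη : ∀ x, HasDerivAt η (M x (η x)) x)
    {x₀ : ℝ} (h : ξ x₀ = η x₀) : ξ = η :=
  ODE_solution_unique_univ (v := fun x y => M x y) (s := fun _ => univ)
    (K := ⟨K, (norm_nonneg _).trans (hK 0)⟩)
    (fun x => ((M x).lipschitz.weaken (hK x)).lipschitzOnWith)
    (fun x => ⟨hξ x, trivial⟩) (fun x => ⟨hη x, trivial⟩) h

end LinearODE

section SolutionSpace

variable {𝕜 E E' : Type*} [RCLike 𝕜] [NormedAddCommGroup E] [NormedSpace 𝕜 E] [NormedSpace ℝ E]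
  [NormedAddCommGroup E'] [NormedSpace 𝕜 E'] [NormedSpace ℝ E']
  {M : ℝ → E →L[𝕜] E} {M' : ℝ → E' →L[𝕜] E'} {K : ℝ} {d : ℕ}

/-- The space of global solutions of the linear differential equation `ξ' = M(x) ξ`. -/
def solutionSpace [SMulCommClass ℝ 𝕜 E] (M : ℝ → E →L[𝕜] E) : Submodule 𝕜 (ℝ → E) where
  carrier := {ξ | ∀ x, HasDerivAt ξ (M x (ξ x)) x}
  zero_mem' := fun x => by simp
  add_mem' := fun hξ hη x => by simpa using (hξ x).add (hη x)
  smul_mem' := fun c ξ hξ x => by simpa using (hξ x).const_smul c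

theorem hasDerivAt_comp_neg {ξ : ℝ → E} (hξ : ∀ x, HasDerivAt ξ (M x (ξ x)) x) (x : ℝ) :
    HasDerivAt (fun x => ξ (-x)) ((-M (-x)) (ξ (-x))) x := by
  simpa [Function.comp_def] using (hξ (-x)).scomp x (hasDerivAt_neg x)

variable [IsScalarTower ℝ 𝕜 E] [IsScalarTower ℝ 𝕜 E']

theorem eval_solutionSpace_bijective [CompleteSpace E] (hM : Continuous M) (hK : ∀ x, ‖M x‖ ≤ K)
    (x : ℝ) :
    Function.Bijective ((LinearMap.proj x : (ℝ → E) →ₗ[𝕜] E) ∘ₗ (solutionSpace M).subtype) := by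
  have hKℝ (x : ℝ) : ‖(M x).restrictScalars ℝ‖ ≤ K := by
    rw [ContinuousLinearMap.norm_restrictScalars]
    exact hK x
  constructor
  · rintro ⟨ξ, hξ⟩ ⟨η, hη⟩ h
    exact Subtype.ext (linearODE_solution_unique hKℝ hξ hη h)
  · intro a
    obtain ⟨ξ, hξ, hξx⟩ := exists_linearODE_solution_through
      ((ContinuousLinearMap.restrictScalarsL 𝕜 E E ℝ ℝ).continuous.comp hM) hKℝ x a
    exact ⟨⟨ξ, hξ⟩, hξx⟩

/-- The solution operator of `ξ' = M(x) ξ` from time `0` to time `x`. -/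
def flow [CompleteSpace E] (hM : Continuous M) (hK : ∀ x, ‖M x‖ ≤ K) (x : ℝ) : E ≃ₗ[𝕜] E :=
  (LinearEquiv.ofBijective _ (eval_solutionSpace_bijective hM hK 0)).symm.trans
    (LinearEquiv.ofBijective _ (eval_solutionSpace_bijective hM hK x))

theorem flow_zero [CompleteSpace E] (hM : Continuous M) (hK : ∀ x, ‖M x‖ ≤ K) (a : E) :
    flow hM hK 0 a = a := by
  simp [flow]

theorem hasDerivAt_flow [CompleteSpace E] (hM : Continuous M) (hK : ∀ x, ‖M x‖ ≤ K) (a : E)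
    (x : ℝ) : HasDerivAt (fun x => flow hM hK x a) (M x (flow hM hK x a)) x :=
  ((LinearEquiv.ofBijective _ (eval_solutionSpace_bijective hM hK 0)).symm a).2 x

/-- The initial values at `0` of the solutions of `ξ' = M(x) ξ` that tend to zero along `l`. -/
def decayValues (M : ℝ → E →L[𝕜] E) (l : Filter ℝ) : Submodule 𝕜 E where
  carrier := {a | ∃ ξ : ℝ → E, (∀ x, HasDerivAt ξ (M x (ξ x)) x) ∧ ξ 0 = a ∧ Tendsto ξ l (𝓝 0)}
  zero_mem' := ⟨0, (solutionSpace M).zero_mem, rfl, tendsto_const_nhds⟩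
  add_mem' := by
    rintro _ _ ⟨ξ, hξ, rfl, hξl⟩ ⟨η, hη, rfl, hηl⟩
    exact ⟨ξ + η, (solutionSpace M).add_mem hξ hη, rfl, by simpa [Pi.add_def] using hξl.add hηl⟩
  smul_mem' := by
    rintro c _ ⟨ξ, hξ, rfl, hξl⟩
    exact ⟨c • ξ, (solutionSpace M).smul_mem c hξ, rfl, by
      simpa [Pi.smul_def] using hξl.const_smul c⟩

theorem decayValues_neg_comp_neg (M : ℝ → E →L[𝕜] E) :
    decayValues (fun x => -M (-x)) atTop = decayValues M atBot := by
  ext a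
  constructor
  · rintro ⟨ξ, hξ, rfl, hlim⟩
    refine ⟨fun x => ξ (-x), fun x => ?_, by simp, hlim.comp tendsto_neg_atBot_atTop⟩
    simpa using hasDerivAt_comp_neg hξ x
  · rintro ⟨ξ, hξ, rfl, hlim⟩
    exact ⟨fun x => ξ (-x), hasDerivAt_comp_neg hξ, by simp, hlim.comp tendsto_neg_atTop_atBot⟩

theorem map_decayValues_le (e : E ≃L[𝕜] E') (he : ∀ x a, e (M x a) = M' x (e a)) (l : Filter ℝ) :
    (decayValues M l).map e.toLinearEquiv.toLinearMap ≤ decayValues M' l := by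
  rintro _ ⟨_, ⟨ξ, hξ, rfl, hlim⟩, rfl⟩
  refine ⟨fun x => e (ξ x), fun x => ?_, rfl, ?_⟩
  · have hderiv := ((e : E →L[𝕜] E').restrictScalars ℝ).hasFDerivAt.comp_hasDerivAt x (hξ x)
    exact hderiv.congr_deriv (he x (ξ x))
  · simpa [Function.comp_def] using (e.continuous.tendsto 0).comp hlim

theorem map_decayValues (e : E ≃L[𝕜] E') (he : ∀ x a, e (M x a) = M' x (e a)) (l : Filter ℝ) :
    (decayValues M l).map e.toLinearEquiv.toLinearMap = decayValues M' l := by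
  refine (map_decayValues_le e he l).antisymm fun b hb => ?_
  have he' (x : ℝ) (b : E') : e.symm (M' x b) = M x (e.symm b) := by
    rw [e.symm_apply_eq, he, e.apply_symm_apply]
  exact ⟨e.symm b, map_decayValues_le e.symm he' l ⟨b, hb, rfl⟩, e.apply_symm_apply b⟩

/-- The solutions of `ξ' = M(x) ξ` decaying at `-∞` and those decaying at `+∞` form spaces of
dimension `d`, which meet only in `0`. The spaces are represented by their values at `0`. -/
def HasDecayDichotomy (M : ℝ → E →L[𝕜] E) (d : ℕ) : Prop :=
  Module.finrank 𝕜 (decayValues M atBot) = d ∧ Module.finrank 𝕜 (decayValues M atTop) = d ∧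
    decayValues M atBot ⊓ decayValues M atTop = ⊥

theorem HasDecayDichotomy.map [FiniteDimensional 𝕜 E] (h : HasDecayDichotomy M d)
    (e : E ≃ₗ[𝕜] E') (he : ∀ x a, e (M x a) = M' x (e a)) : HasDecayDichotomy M' d := by
  obtain ⟨hbot, htop, hinf⟩ := h
  have hmap := map_decayValues e.toContinuousLinearEquiv he
  refine ⟨?_, ?_, ?_⟩
  · rw [← hmap, LinearEquiv.finrank_map_eq, hbot]
  · rw [← hmap, LinearEquiv.finrank_map_eq, htop]
  · rw [← hmap, ← hmap, ← Submodule.map_inf _ (LinearEquiv.injective _), hinf, Submodule.map_bot]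

end SolutionSpace

section Lyapunov

open RCLike (re)
open scoped InnerProductSpace

variable {𝕜 W : Type*} [RCLike 𝕜] [NormedAddCommGroup W] [InnerProductSpace 𝕜 W]
  {S M₀ M₁ : W →L[𝕜] W} {δ : ℝ}

theorem abs_reApplyInnerSelf_le (S : W →L[𝕜] W) (ξ : W) :
    |S.reApplyInnerSelf ξ| ≤ ‖S‖ * ‖ξ‖ ^ 2 := by
  calc |S.reApplyInnerSelf ξ| ≤ ‖S ξ‖ * ‖ξ‖ :=
        (RCLike.abs_re_le_norm _).trans (norm_inner_le_norm _ _)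
    _ ≤ ‖S‖ * ‖ξ‖ * ‖ξ‖ := by gcongr; exact S.le_opNorm ξ
    _ = ‖S‖ * ‖ξ‖ ^ 2 := by ring

/-- The form `⟪S ξ, ξ⟫` of a symmetric operator `S` grows strictly along the solutions of
`ξ' = M₀ ξ`, at a rate of at least `2 δ ‖ξ‖²`. -/
def IsStrictLyapunov (S M₀ : W →L[𝕜] W) (δ : ℝ) : Prop :=
  ∀ ξ, δ * ‖ξ‖ ^ 2 ≤ re ⟪S ξ, M₀ ξ⟫_𝕜

theorem IsStrictLyapunov.of_norm_sub_le (h : IsStrictLyapunov S M₀ δ)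
    (hM : ‖S‖ * ‖M₁ - M₀‖ ≤ δ / 2) : IsStrictLyapunov S M₁ (δ / 2) := fun ξ => by
  have hdiff : |re ⟪S ξ, (M₁ - M₀) ξ⟫_𝕜| ≤ δ / 2 * ‖ξ‖ ^ 2 := by
    calc |re ⟪S ξ, (M₁ - M₀) ξ⟫_𝕜| ≤ ‖S ξ‖ * ‖(M₁ - M₀) ξ‖ :=
          (RCLike.abs_re_le_norm _).trans (norm_inner_le_norm _ _)
      _ ≤ (‖S‖ * ‖ξ‖) * (‖M₁ - M₀‖ * ‖ξ‖) := by
          gcongr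
          exacts [S.le_opNorm ξ, (M₁ - M₀).le_opNorm ξ]
      _ = ‖S‖ * ‖M₁ - M₀‖ * ‖ξ‖ ^ 2 := by ring
      _ ≤ δ / 2 * ‖ξ‖ ^ 2 := by gcongr
  have hsplit : re ⟪S ξ, M₁ ξ⟫_𝕜 = re ⟪S ξ, M₀ ξ⟫_𝕜 + re ⟪S ξ, (M₁ - M₀) ξ⟫_𝕜 := by
    rw [← map_add, ← inner_add_right, sub_apply, add_sub_cancel]
  linarith [h ξ, neg_abs_le (re ⟪S ξ, (M₁ - M₀) ξ⟫_𝕜)]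

theorem IsStrictLyapunov.neg_neg (h : IsStrictLyapunov S M₀ δ) : IsStrictLyapunov (-S) (-M₀) δ :=
  fun ξ => by simpa using h ξ

theorem reApplyInnerSelf_neg (S : W →L[𝕜] W) (ξ : W) :
    (-S).reApplyInnerSelf ξ = -S.reApplyInnerSelf ξ := by
  simp [ContinuousLinearMap.reApplyInnerSelf_apply]

theorem tendsto_reApplyInnerSelf_zero (S : W →L[𝕜] W) {ξ : ℝ → W} {l : Filter ℝ}
    (hξ : Tendsto ξ l (𝓝 0)) :
    Tendsto (fun x => S.reApplyInnerSelf (ξ x)) l (𝓝 0) := by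
  simpa [ContinuousLinearMap.reApplyInnerSelf_apply, Function.comp_def] using
    (S.reApplyInnerSelf_continuous.tendsto 0).comp hξ

theorem tendsto_zero_of_deriv_le_neg_mul {F F' : ℝ → ℝ} {c : ℝ} (hc : 0 < c)
    (hF : ∀ x, HasDerivAt F (F' x) x) (hle : ∀ x, F' x ≤ -c * F x)
    (hnonneg : ∀ x, 0 ≤ x → 0 ≤ F x) : Tendsto F atTop (𝓝 0) := by
  have hexp (x : ℝ) : HasDerivAt (fun x => Real.exp (c * x)) (Real.exp (c * x) * c) x := by
    simpa using ((hasDerivAt_id x).const_mul c).exp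
  have hanti : Antitone fun x => Real.exp (c * x) * F x :=
    antitone_of_hasDerivAt_nonpos (fun x => (hexp x).mul (hF x)) fun x => by
      have := mul_le_mul_of_nonneg_left (hle x) (Real.exp_pos (c * x)).le
      simp only [Pi.zero_apply]
      linarith
  have hbound (x : ℝ) (hx : 0 ≤ x) : F x ≤ F 0 * Real.exp (-(c * x)) := by
    rw [Real.exp_neg, ← div_eq_mul_inv, le_div_iff₀ (Real.exp_pos _), mul_comm]
    simpa using hanti hx
  have hlim : Tendsto (fun x => F 0 * Real.exp (-(c * x))) atTop (𝓝 0) := by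
    simpa using (Real.tendsto_exp_neg_atTop_nhds_zero.comp
      (tendsto_id.const_mul_atTop hc)).const_mul (F 0)
  exact squeeze_zero' ((eventually_ge_atTop 0).mono hnonneg)
    ((eventually_ge_atTop 0).mono hbound) hlim

theorem IsStrictLyapunov.re_inner_sub_le (h : IsStrictLyapunov S M₀ δ) {K q : ℝ} (hK : ‖M₀‖ ≤ K)
    (hq : 0 ≤ q) (hqδ : q * δ = K + 1) (ξ : W) :
    2 * re ⟪ξ, M₀ ξ⟫_𝕜 - q * (2 * re ⟪S ξ, M₀ ξ⟫_𝕜) ≤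
      -(2 / (1 + q * ‖S‖)) * (‖ξ‖ ^ 2 - q * S.reApplyInnerSelf ξ) := by
  have hgrowth : re ⟪ξ, M₀ ξ⟫_𝕜 ≤ K * ‖ξ‖ ^ 2 := by
    calc re ⟪ξ, M₀ ξ⟫_𝕜 ≤ ‖ξ‖ * (K * ‖ξ‖) :=
          (re_inner_le_norm _ _).trans (by gcongr; exact M₀.le_of_opNorm_le hK _)
      _ = K * ‖ξ‖ ^ 2 := by ring
  have hdamping : (K + 1) * ‖ξ‖ ^ 2 ≤ q * re ⟪S ξ, M₀ ξ⟫_𝕜 := by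
    rw [← hqδ, mul_assoc]
    exact mul_le_mul_of_nonneg_left (h ξ) hq
  have hform : -(q * S.reApplyInnerSelf ξ) ≤ q * (‖S‖ * ‖ξ‖ ^ 2) := by
    rw [← mul_neg]
    exact mul_le_mul_of_nonneg_left ((neg_le_abs _).trans (abs_reApplyInnerSelf_le S ξ)) hq
  have hrate : 2 / (1 + q * ‖S‖) * (‖ξ‖ ^ 2 - q * S.reApplyInnerSelf ξ) ≤ 2 * ‖ξ‖ ^ 2 := by
    rw [div_mul_eq_mul_div, div_le_iff₀ (by positivity)]
    linarith
  linarith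

theorem exists_submodule_forall_subset [FiniteDimensional 𝕜 W] {m : ℕ} {C : ℕ → Set W}
    (hC : ∀ i, IsClosed (C i)) (hanti : Antitone C)
    (hne : ∀ i, ∃ N : Submodule 𝕜 W, Module.finrank 𝕜 N = m ∧ (N : Set W) ⊆ C i) :
    ∃ N : Submodule 𝕜 W, Module.finrank 𝕜 N = m ∧ ∀ i, (N : Set W) ⊆ C i := by
  have : ProperSpace W := FiniteDimensional.proper 𝕜 W
  -- Subspaces are replaced by their orthonormal bases, which live in a compact set.
  let frames : ℕ → Set (Fin m → W) := fun i =>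
    {u | Orthonormal 𝕜 u ∧ ∀ c : Fin m → 𝕜, ∑ j, c j • u j ∈ C i}
  have hclosed (i : ℕ) : IsClosed (frames i) := by
    have hframes : frames i =
        (⋂ j, ⋂ l, {u : Fin m → W | ⟪u j, u l⟫_𝕜 = if j = l then 1 else 0}) ∩
          ⋂ c : Fin m → 𝕜, {u | ∑ j, c j • u j ∈ C i} := by
      ext u
      simp [frames, orthonormal_iff_ite]
    rw [hframes]
    refine IsClosed.inter (isClosed_iInter fun j => isClosed_iInter fun l => ?_)
      (isClosed_iInter fun c => (hC i).preimage (by fun_prop))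
    exact isClosed_eq ((continuous_apply j).inner (continuous_apply l)) continuous_const
  have hcompact : IsCompact (frames 0) := by
    refine (isCompact_univ_pi fun _ => isCompact_closedBall (0 : W) 1).of_isClosed_subset
      (hclosed 0) fun u hu j _ => ?_
    simp [hu.1.1 j]
  obtain ⟨u, hu⟩ := IsCompact.nonempty_iInter_of_sequence_nonempty_isCompact_isClosed frames
    (fun i u hu => ⟨hu.1, fun c => hanti i.le_succ (hu.2 c)⟩)
    (fun i => by
      obtain ⟨N, hN, hNC⟩ := hne i
      let b := (stdOrthonormalBasis 𝕜 N).reindex (finCongr hN)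
      exact ⟨fun j => b j, b.orthonormal.comp_linearIsometry N.subtypeₗᵢ,
        fun c => hNC (N.sum_mem fun j _ => N.smul_mem _ (b j).2)⟩)
    hcompact hclosed
  rw [mem_iInter] at hu
  refine ⟨Submodule.span 𝕜 (range u), ?_, fun i x hx => ?_⟩
  · simpa using finrank_span_eq_card (hu 0).1.linearIndependent
  · obtain ⟨c, rfl⟩ := (Submodule.mem_span_range_iff_exists_fun 𝕜).1 hx
    exact (hu i).2 c

variable [NormedSpace ℝ W] [IsScalarTower ℝ 𝕜 W] {M : ℝ → W →L[𝕜] W} {K : ℝ}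
  {ξ : ℝ → W} {ξ' : W} {x : ℝ}

theorem hasDerivAt_reApplyInnerSelf (hS : S.IsSymmetric) (hξ : HasDerivAt ξ ξ' x) :
    HasDerivAt (fun x => S.reApplyInnerSelf (ξ x)) (2 * re ⟪S (ξ x), ξ'⟫_𝕜) x := by
  have hSξ : HasDerivAt (fun x => S (ξ x)) (S ξ') x :=
    (S.restrictScalars ℝ).hasFDerivAt.comp_hasDerivAt x hξ
  refine (RCLike.reCLM.hasFDerivAt.comp_hasDerivAt x (hSξ.inner 𝕜 hξ)).congr_deriv ?_
  have hsymm : re ⟪S ξ', ξ x⟫_𝕜 = re ⟪S (ξ x), ξ'⟫_𝕜 := by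
    rw [← inner_re_symm]
    exact congrArg re (hS (ξ x) ξ').symm
  rw [RCLike.reCLM_apply, map_add, hsymm]
  ring

theorem hasDerivAt_norm_sq (hξ : HasDerivAt ξ ξ' x) :
    HasDerivAt (fun x => ‖ξ x‖ ^ 2) (2 * re ⟪ξ x, ξ'⟫_𝕜) x := by
  have h := hasDerivAt_reApplyInnerSelf (S := ContinuousLinearMap.id 𝕜 W)
    LinearMap.IsSymmetric.id hξ
  simpa only [ContinuousLinearMap.reApplyInnerSelf_apply, ContinuousLinearMap.id_apply,
    inner_self_eq_norm_sq] using h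

theorem monotone_reApplyInnerSelf (hS : S.IsSymmetric) (hδ : 0 ≤ δ)
    (hL : ∀ x, IsStrictLyapunov S (M x) δ) (hξ : ∀ x, HasDerivAt ξ (M x (ξ x)) x) :
    Monotone fun x => S.reApplyInnerSelf (ξ x) :=
  monotone_of_hasDerivAt_nonneg (fun x => hasDerivAt_reApplyInnerSelf hS (hξ x)) fun x => by
    have : 0 ≤ δ * ‖ξ x‖ ^ 2 := by positivity
    simp only [Pi.zero_apply]
    linarith [hL x (ξ x)]

theorem reApplyInnerSelf_nonpos_of_tendsto (hS : S.IsSymmetric) (hδ : 0 ≤ δ)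
    (hL : ∀ x, IsStrictLyapunov S (M x) δ) (hξ : ∀ x, HasDerivAt ξ (M x (ξ x)) x)
    (hlim : Tendsto ξ atTop (𝓝 0)) (x : ℝ) : S.reApplyInnerSelf (ξ x) ≤ 0 :=
  (monotone_reApplyInnerSelf hS hδ hL hξ).ge_of_tendsto (tendsto_reApplyInnerSelf_zero S hlim) x

theorem eq_zero_of_tendsto_atBot_atTop (hS : S.IsSymmetric) (hδ : 0 < δ)
    (hL : ∀ x, IsStrictLyapunov S (M x) δ) (hξ : ∀ x, HasDerivAt ξ (M x (ξ x)) x)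
    (hbot : Tendsto ξ atBot (𝓝 0)) (htop : Tendsto ξ atTop (𝓝 0)) (x : ℝ) : ξ x = 0 := by
  have hmono := monotone_reApplyInnerSelf hS hδ.le hL hξ
  have hconst : (fun x => S.reApplyInnerSelf (ξ x)) = fun _ => 0 := funext fun x =>
    le_antisymm (hmono.ge_of_tendsto (tendsto_reApplyInnerSelf_zero S htop) x)
      (hmono.le_of_tendsto (tendsto_reApplyInnerSelf_zero S hbot) x)
  have hderiv := hasDerivAt_reApplyInnerSelf hS (hξ x)
  rw [hconst] at hderiv
  have hzero := hderiv.unique (hasDerivAt_const x 0)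
  have hle : δ * ‖ξ x‖ ^ 2 ≤ 0 := by linarith [hL x (ξ x)]
  by_contra hne
  have : 0 < ‖ξ x‖ := norm_pos_iff.2 hne
  exact hle.not_gt (by positivity)

theorem tendsto_zero_of_reApplyInnerSelf_nonpos (hK : ∀ x, ‖M x‖ ≤ K) (hS : S.IsSymmetric)
    (hδ : 0 < δ) (hL : ∀ x, IsStrictLyapunov S (M x) δ)
    (hξ : ∀ x, HasDerivAt ξ (M x (ξ x)) x)
    (hneg : ∀ x, 0 ≤ x → S.reApplyInnerSelf (ξ x) ≤ 0) : Tendsto ξ atTop (𝓝 0) := by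
  have hK₀ : 0 ≤ K := (norm_nonneg _).trans (hK 0)
  obtain ⟨q, hq, hqδ⟩ : ∃ q, 0 < q ∧ q * δ = K + 1 :=
    ⟨(K + 1) / δ, by positivity, div_mul_cancel₀ _ hδ.ne'⟩
  -- For large `q`, the form `‖ξ‖² - q ⟪S ξ, ξ⟫` decays exponentially along every solution,
  -- and it dominates `‖ξ‖²` where `⟪S ξ, ξ⟫ ≤ 0`.
  have hle (x : ℝ) (hx : 0 ≤ x) : ‖ξ x‖ ^ 2 ≤ ‖ξ x‖ ^ 2 - q * S.reApplyInnerSelf (ξ x) := by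
    linarith [mul_nonneg hq.le (neg_nonneg.2 (hneg x hx))]
  have hlim : Tendsto (fun x => ‖ξ x‖ ^ 2 - q * S.reApplyInnerSelf (ξ x)) atTop (𝓝 0) :=
    tendsto_zero_of_deriv_le_neg_mul (c := 2 / (1 + q * ‖S‖)) (by positivity)
      (fun x => (hasDerivAt_norm_sq (hξ x)).sub
        ((hasDerivAt_reApplyInnerSelf hS (hξ x)).const_mul q))
      (fun x => (hL x).re_inner_sub_le (hK x) hq.le hqδ (ξ x))
      fun x hx => (sq_nonneg _).trans (hle x hx)
  have hsq : Tendsto (fun x => ‖ξ x‖ ^ 2) atTop (𝓝 0) :=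
    squeeze_zero' (Eventually.of_forall fun x => by positivity)
      ((eventually_ge_atTop 0).mono hle) hlim
  rw [tendsto_zero_iff_norm_tendsto_zero]
  simpa using hsq.sqrt

variable [FiniteDimensional 𝕜 W] {N P : Submodule 𝕜 W} {d : ℕ}

theorem finrank_decayValues_le (hS : S.IsSymmetric) (hδ : 0 ≤ δ)
    (hL : ∀ x, IsStrictLyapunov S (M x) δ) (hP : ∀ ξ ∈ P, ξ ≠ 0 → 0 < S.reApplyInnerSelf ξ) :
    Module.finrank 𝕜 (decayValues M atTop) + Module.finrank 𝕜 P ≤ Module.finrank 𝕜 W := by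
  refine Submodule.finrank_add_finrank_le_of_disjoint (Submodule.disjoint_def.2 ?_)
  rintro _ ⟨ξ, hξ, rfl, hlim⟩ hmem
  by_contra hne
  exact (reApplyInnerSelf_nonpos_of_tendsto hS hδ hL hξ hlim 0).not_gt (hP _ hmem hne)

theorem le_finrank_decayValues (hM : Continuous M) (hK : ∀ x, ‖M x‖ ≤ K) (hS : S.IsSymmetric)
    (hδ : 0 < δ) (hL : ∀ x, IsStrictLyapunov S (M x) δ)
    (hN : ∀ ξ ∈ N, S.reApplyInnerSelf ξ ≤ 0) :
    Module.finrank 𝕜 N ≤ Module.finrank 𝕜 (decayValues M atTop) := by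
  have : CompleteSpace W := FiniteDimensional.complete 𝕜 W
  have hmono (a : W) := monotone_reApplyInnerSelf hS hδ.le hL (hasDerivAt_flow hM hK a)
  obtain ⟨N', hN', hsub⟩ := exists_submodule_forall_subset (m := Module.finrank 𝕜 N)
    (C := fun i : ℕ => {a | S.reApplyInnerSelf (flow hM hK i a) ≤ 0})
    (fun i => isClosed_le (S.reApplyInnerSelf_continuous.comp
      (flow hM hK i).toLinearMap.continuous_of_finiteDimensional) continuous_const)
    (fun i j hij a ha => (hmono a (Nat.cast_le.2 hij)).trans ha)
    (fun i => ⟨N.map (flow hM hK i).symm.toLinearMap, LinearEquiv.finrank_map_eq _ _, by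
      rintro _ ⟨b, hb, rfl⟩
      simpa using hN b hb⟩)
  rw [← hN']
  refine Submodule.finrank_mono fun a ha =>
    ⟨fun x => flow hM hK x a, hasDerivAt_flow hM hK a, flow_zero hM hK a, ?_⟩
  exact tendsto_zero_of_reApplyInnerSelf_nonpos hK hS hδ hL (hasDerivAt_flow hM hK a)
    fun x _ => (hmono a (Nat.le_ceil x)).trans (hsub ⌈x⌉₊ ha)

theorem finrank_decayValues_atTop (hM : Continuous M) (hK : ∀ x, ‖M x‖ ≤ K)
    (hS : S.IsSymmetric) (hδ : 0 < δ) (hL : ∀ x, IsStrictLyapunov S (M x) δ)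
    (hN : ∀ ξ ∈ N, ξ ≠ 0 → S.reApplyInnerSelf ξ < 0)
    (hP : ∀ ξ ∈ P, ξ ≠ 0 → 0 < S.reApplyInnerSelf ξ)
    (hNP : Module.finrank 𝕜 N + Module.finrank 𝕜 P = Module.finrank 𝕜 W) :
    Module.finrank 𝕜 (decayValues M atTop) = Module.finrank 𝕜 N := by
  have hN_nonpos (ξ : W) (hξ : ξ ∈ N) : S.reApplyInnerSelf ξ ≤ 0 := by
    rcases eq_or_ne ξ 0 with rfl | hne
    · simp [ContinuousLinearMap.reApplyInnerSelf_apply]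
    · exact (hN ξ hξ hne).le
  have hle := finrank_decayValues_le hS hδ.le hL hP
  exact le_antisymm (by omega) (le_finrank_decayValues hM hK hS hδ hL hN_nonpos)

theorem disjoint_decayValues_atBot_atTop (hM : Continuous M) (hK : ∀ x, ‖M x‖ ≤ K)
    (hS : S.IsSymmetric) (hδ : 0 < δ) (hL : ∀ x, IsStrictLyapunov S (M x) δ) :
    Disjoint (decayValues M atBot) (decayValues M atTop) := by
  have : CompleteSpace W := FiniteDimensional.complete 𝕜 W
  refine Submodule.disjoint_def.2 ?_
  rintro _ ⟨ξ, hξ, rfl, hbot⟩ ⟨η, hη, h₀, htop⟩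
  have hηξ : η = ξ := congrArg Subtype.val
    ((eval_solutionSpace_bijective hM hK 0).1 (a₁ := ⟨η, hη⟩) (a₂ := ⟨ξ, hξ⟩) h₀)
  exact eq_zero_of_tendsto_atBot_atTop hS hδ hL hξ hbot (hηξ ▸ htop) 0

theorem hasDecayDichotomy_of_isStrictLyapunov (hM : Continuous M) (hK : ∀ x, ‖M x‖ ≤ K)
    (hS : S.IsSymmetric) (hδ : 0 < δ) (hL : ∀ x, IsStrictLyapunov S (M x) δ)
    (hN : ∀ ξ ∈ N, ξ ≠ 0 → S.reApplyInnerSelf ξ < 0)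
    (hP : ∀ ξ ∈ P, ξ ≠ 0 → 0 < S.reApplyInnerSelf ξ)
    (hNd : Module.finrank 𝕜 N = d) (hPd : Module.finrank 𝕜 P = d)
    (hW : Module.finrank 𝕜 W = d + d) : HasDecayDichotomy M d := by
  refine ⟨?_, ?_, (disjoint_decayValues_atBot_atTop hM hK hS hδ hL).eq_bot⟩
  · -- Reversing `x` turns `S` into a Lyapunov form of the opposite sign.
    rw [← decayValues_neg_comp_neg, ← hPd]
    refine finrank_decayValues_atTop (S := -S) (K := K) (N := P) (P := N)
      (hM.comp continuous_neg).neg (fun x => by simpa using hK (-x)) (fun a b => ?_) hδ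
      (fun x => (hL (-x)).neg_neg) (fun ξ hξ hne => ?_) (fun ξ hξ hne => ?_) (by omega)
    · simpa using hS a b
    · simpa [reApplyInnerSelf_neg] using hP ξ hξ hne
    · simpa [reApplyInnerSelf_neg] using hN ξ hξ hne
  · rw [← hNd]
    exact finrank_decayValues_atTop hM hK hS hδ hL hN hP (by omega)

end Lyapunov

section BlockOperators

open scoped InnerProductSpace

variable {𝕜 V : Type*} [RCLike 𝕜] [NormedAddCommGroup V] [InnerProductSpace 𝕜 V]

/-- The operator on `V × V` with the block matrix `[[a, b], [c, d]]`. -/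
def blockOp (a b c d : V →L[𝕜] V) : WithLp 2 (V × V) →L[𝕜] WithLp 2 (V × V) :=
  (WithLp.prodContinuousLinearEquiv 2 𝕜 V V).symm.toContinuousLinearMap ∘L
    (.inl 𝕜 V V ∘L (a ∘L .fst 𝕜 V V + b ∘L .snd 𝕜 V V) +
      .inr 𝕜 V V ∘L (c ∘L .fst 𝕜 V V + d ∘L .snd 𝕜 V V)) ∘L
    (WithLp.prodContinuousLinearEquiv 2 𝕜 V V).toContinuousLinearMap

@[simp] theorem blockOp_apply_fst (a b c d : V →L[𝕜] V) (ξ : WithLp 2 (V × V)) :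
    (blockOp a b c d ξ).fst = a ξ.fst + b ξ.snd :=
  add_zero _

@[simp] theorem blockOp_apply_snd (a b c d : V →L[𝕜] V) (ξ : WithLp 2 (V × V)) :
    (blockOp a b c d ξ).snd = c ξ.fst + d ξ.snd :=
  zero_add _

theorem inner_withLp_prod (ξ η : WithLp 2 (V × V)) :
    ⟪ξ, η⟫_𝕜 = ⟪ξ.fst, η.fst⟫_𝕜 + ⟪ξ.snd, η.snd⟫_𝕜 :=
  rfl

theorem norm_le_norm_fst_add_norm_snd (ξ : WithLp 2 (V × V)) : ‖ξ‖ ≤ ‖ξ.fst‖ + ‖ξ.snd‖ := by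
  refine le_of_sq_le_sq ?_ (by positivity)
  rw [WithLp.prod_norm_sq_eq_of_L2]
  nlinarith [norm_nonneg ξ.fst, norm_nonneg ξ.snd]

theorem norm_blockOp_le (a b c d : V →L[𝕜] V) :
    ‖blockOp a b c d‖ ≤ ‖a‖ + ‖b‖ + (‖c‖ + ‖d‖) := by
  refine ContinuousLinearMap.opNorm_le_bound _ (by positivity) fun ξ => ?_
  have hrow (a b : V →L[𝕜] V) : ‖a ξ.fst + b ξ.snd‖ ≤ (‖a‖ + ‖b‖) * ‖ξ‖ := by
    rw [add_mul]
    exact (norm_add_le _ _).trans (add_le_add (a.le_opNorm_of_le (WithLp.norm_fst_le _ ξ))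
      (b.le_opNorm_of_le (WithLp.norm_snd_le _ ξ)))
  calc ‖blockOp a b c d ξ‖ ≤ ‖(blockOp a b c d ξ).fst‖ + ‖(blockOp a b c d ξ).snd‖ :=
        norm_le_norm_fst_add_norm_snd _
    _ ≤ (‖a‖ + ‖b‖) * ‖ξ‖ + (‖c‖ + ‖d‖) * ‖ξ‖ := by
        rw [blockOp_apply_fst, blockOp_apply_snd]
        exact add_le_add (hrow a b) (hrow c d)
    _ = (‖a‖ + ‖b‖ + (‖c‖ + ‖d‖)) * ‖ξ‖ := by ring

/-- The subspace `{(p, c p)}` of `V × V`. -/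
def scalarGraph (V : Type*) [NormedAddCommGroup V] [InnerProductSpace 𝕜 V] (c : 𝕜) :
    Submodule 𝕜 (WithLp 2 (V × V)) :=
  LinearMap.range ((WithLp.linearEquiv 2 𝕜 (V × V)).symm.toLinearMap ∘ₗ
    LinearMap.prod LinearMap.id (c • LinearMap.id))

theorem finrank_scalarGraph (c : 𝕜) :
    Module.finrank 𝕜 (scalarGraph V c) = Module.finrank 𝕜 V :=
  LinearMap.finrank_range_of_inj fun _ _ h => congrArg (fun ξ => ξ.fst) h

/-- The coefficient operator of the system `p' = A p + κ w`, `w' = (κ + B) p`. -/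
def modeOp (κ : 𝕜) (A B : V →L[𝕜] V) : WithLp 2 (V × V) →L[𝕜] WithLp 2 (V × V) :=
  blockOp A (κ • .id 𝕜 V) (κ • .id 𝕜 V + B) 0

theorem continuous_modeOp {X : Type*} [TopologicalSpace X] (κ : 𝕜) {A B : X → V →L[𝕜] V}
    (hA : Continuous A) (hB : Continuous B) : Continuous fun x => modeOp κ (A x) (B x) := by
  unfold modeOp blockOp
  fun_prop

theorem norm_modeOp_sub_le (κ : 𝕜) (A B A₀ B₀ : V →L[𝕜] V) :
    ‖modeOp κ A B - modeOp κ A₀ B₀‖ ≤ ‖A - A₀‖ + ‖B - B₀‖ := by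
  have hsub : modeOp κ A B - modeOp κ A₀ B₀ = blockOp (A - A₀) 0 (B - B₀) 0 := by
    refine ContinuousLinearMap.ext fun ξ => WithLp.ofLp_injective _ (Prod.ext ?_ ?_)
    · change (modeOp κ A B ξ).fst - (modeOp κ A₀ B₀ ξ).fst = (blockOp _ _ _ _ ξ).fst
      simp [modeOp]
    · change (modeOp κ A B ξ).snd - (modeOp κ A₀ B₀ ξ).snd = (blockOp _ _ _ _ ξ).snd
      simp [modeOp]
  simpa [hsub] using norm_blockOp_le (A - A₀) 0 (B - B₀) 0

/-- The symmetric operator of the form `⟪R u, u⟫ - ⟪T z, z⟫ + 2 Re ⟪σ w, p⟫` on pairs `(p, w)`,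
where `u = p + w` and `z = p - w`. -/
def lyapOp (R T : V →L[𝕜] V) (σ : 𝕜) : WithLp 2 (V × V) →L[𝕜] WithLp 2 (V × V) :=
  blockOp (R - T) (R + T + σ • .id 𝕜 V) (R + T + (starRingEnd 𝕜 σ) • .id 𝕜 V) (R - T)

end BlockOperators

section ModeLyapunov

open RCLike (re im)
open scoped InnerProductSpace

variable {𝕜 V : Type*} [RCLike 𝕜] [NormedAddCommGroup V] [InnerProductSpace 𝕜 V]
  {R T A B : V →L[𝕜] V} {κ σ : 𝕜} {θ r : ℝ}

theorem isSymmetric_lyapOp (hR : R.IsSymmetric) (hT : T.IsSymmetric) (σ : 𝕜) :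
    (lyapOp R T σ).IsSymmetric := fun ξ η => by
  have hR' (p q : V) : ⟪R p, q⟫_𝕜 = ⟪p, R q⟫_𝕜 := hR p q
  have hT' (p q : V) : ⟪T p, q⟫_𝕜 = ⟪p, T q⟫_𝕜 := hT p q
  simp only [lyapOp, ContinuousLinearMap.coe_coe, inner_withLp_prod, blockOp_apply_fst,
    blockOp_apply_snd, _root_.add_apply, _root_.sub_apply, _root_.smul_apply,
    ContinuousLinearMap.id_apply, inner_add_left, inner_add_right, inner_sub_left,
    inner_sub_right, inner_smul_left, inner_smul_right, hR', hT', RCLike.conj_conj]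
  ring

theorem norm_lyapOp_le (R T : V →L[𝕜] V) (σ : 𝕜) :
    ‖lyapOp R T σ‖ ≤ 4 * (‖R‖ + ‖T‖) + 2 * ‖σ‖ := by
  have hoff (τ : 𝕜) : ‖R + T + τ • .id 𝕜 V‖ ≤ ‖R‖ + ‖T‖ + ‖τ‖ := by
    refine (norm_add_le _ _).trans (add_le_add (norm_add_le _ _) ?_)
    rw [norm_smul]
    exact mul_le_of_le_one_right (norm_nonneg _) ContinuousLinearMap.norm_id_le
  have hconj := hoff (starRingEnd 𝕜 σ)
  rw [RCLike.norm_conj] at hconj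
  refine (norm_blockOp_le _ _ _ _).trans ?_
  linarith [norm_sub_le R T, hoff σ]

theorem reApplyInnerSelf_lyapOp_diag (R T : V →L[𝕜] V) (σ : 𝕜) (p : V) :
    (lyapOp R T σ).reApplyInnerSelf (WithLp.toLp 2 (p, p)) =
      4 * R.reApplyInnerSelf p + 2 * re σ * ‖p‖ ^ 2 := by
  simp only [ContinuousLinearMap.reApplyInnerSelf_apply, lyapOp, inner_withLp_prod,
    blockOp_apply_fst, blockOp_apply_snd, WithLp.toLp_fst, WithLp.toLp_snd,
    _root_.add_apply, _root_.sub_apply, _root_.smul_apply, ContinuousLinearMap.id_apply,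
    inner_add_left, inner_sub_left, inner_smul_left, inner_self_eq_norm_sq_to_K, map_add, map_sub,
    ← RCLike.ofReal_pow, RCLike.re_mul_ofReal, RCLike.conj_re, RCLike.conj_conj]
  ring

theorem reApplyInnerSelf_lyapOp_antidiag (R T : V →L[𝕜] V) (σ : 𝕜) (p : V) :
    (lyapOp R T σ).reApplyInnerSelf (WithLp.toLp 2 (p, -p)) =
      -(4 * T.reApplyInnerSelf p + 2 * re σ * ‖p‖ ^ 2) := by
  simp only [ContinuousLinearMap.reApplyInnerSelf_apply, lyapOp, inner_withLp_prod,
    blockOp_apply_fst, blockOp_apply_snd, WithLp.toLp_fst, WithLp.toLp_snd,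
    _root_.add_apply, _root_.sub_apply, _root_.smul_apply, ContinuousLinearMap.id_apply,
    inner_add_left, inner_sub_left, inner_smul_left, inner_neg_left, inner_neg_right,
    inner_self_eq_norm_sq_to_K, map_neg, map_add, map_sub, ← RCLike.ofReal_pow,
    RCLike.re_mul_ofReal, RCLike.conj_re, RCLike.conj_conj]
  ring

theorem reApplyInnerSelf_lyapOp_pos_of_mem_scalarGraph
    (hR : ∀ p, p ≠ 0 → 0 < R.reApplyInnerSelf p) (hσ : 0 ≤ re σ) {ξ : WithLp 2 (V × V)}
    (hξ : ξ ∈ scalarGraph V (1 : 𝕜)) (hne : ξ ≠ 0) :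
    0 < (lyapOp R T σ).reApplyInnerSelf ξ := by
  obtain ⟨p, rfl⟩ : ∃ p : V, WithLp.toLp 2 (p, (1 : 𝕜) • p) = ξ := hξ
  rw [one_smul, reApplyInnerSelf_lyapOp_diag]
  have := hR p fun hp => hne (by simp [hp])
  positivity

theorem reApplyInnerSelf_lyapOp_neg_of_mem_scalarGraph
    (hT : ∀ p, p ≠ 0 → 0 < T.reApplyInnerSelf p) (hσ : 0 ≤ re σ) {ξ : WithLp 2 (V × V)}
    (hξ : ξ ∈ scalarGraph V (-1 : 𝕜)) (hne : ξ ≠ 0) :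
    (lyapOp R T σ).reApplyInnerSelf ξ < 0 := by
  obtain ⟨p, rfl⟩ : ∃ p : V, WithLp.toLp 2 (p, (-1 : 𝕜) • p) = ξ := hξ
  rw [neg_one_smul, reApplyInnerSelf_lyapOp_antidiag]
  have := hT p fun hp => hne (by simp [hp])
  exact neg_neg_of_pos (by positivity)

theorem inner_lyapOp_modeOp (R T A B : V →L[𝕜] V) (σ κ : 𝕜) (p w : V) :
    ⟪lyapOp R T σ (WithLp.toLp 2 (p, w)), modeOp κ A B (WithLp.toLp 2 (p, w))⟫_𝕜 =
      ⟪R (p + w), (A + B) p + κ • (p + w)⟫_𝕜 + ⟪T (p - w), (B - A) p + κ • (p - w)⟫_𝕜 +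
      ⟪σ • w, A p + κ • w⟫_𝕜 + ⟪(starRingEnd 𝕜 σ) • p, κ • p + B p⟫_𝕜 := by
  simp only [lyapOp, modeOp, inner_withLp_prod, blockOp_apply_fst, blockOp_apply_snd,
    WithLp.toLp_fst, WithLp.toLp_snd, _root_.add_apply, _root_.sub_apply, _root_.smul_apply,
    ContinuousLinearMap.id_apply, _root_.zero_apply, map_add, map_sub, smul_add, smul_sub,
    inner_add_left, inner_add_right, inner_sub_left, inner_sub_right, inner_smul_left,
    inner_smul_right, inner_zero_right, RCLike.conj_conj]
  ring

theorem re_inner_le_re_inner_inverse_add_smul {D : V →L[𝕜] V} (hR : R.IsSymmetric)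
    (hR₀ : ∀ u, 0 ≤ R.reApplyInnerSelf u) (hRD : R ∘L D = .id 𝕜 V) (hκ : 0 ≤ re κ) (u p : V) :
    re ⟪u, p⟫_𝕜 ≤ re ⟪R u, D p + κ • u⟫_𝕜 := by
  have hRDp : ⟪R u, D p⟫_𝕜 = ⟪u, p⟫_𝕜 := by
    rw [show ⟪R u, D p⟫_𝕜 = ⟪u, R (D p)⟫_𝕜 from hR u (D p)]
    exact congrArg _ (DFunLike.congr_fun hRD p)
  have hreal : im ⟪R u, u⟫_𝕜 = 0 := hR.im_inner_apply_self u
  rw [inner_add_right, inner_smul_right, hRDp, map_add, RCLike.mul_re, hreal, mul_zero, sub_zero]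
  exact le_add_of_nonneg_right (mul_nonneg hκ (hR₀ u))

theorem neg_norm_mul_norm_le_re_inner (x y : V) : -(‖x‖ * ‖y‖) ≤ re ⟪x, y⟫_𝕜 :=
  neg_le_of_abs_le ((RCLike.abs_re_le_norm _).trans (norm_inner_le_norm x y))

theorem exists_conj_mul_eq_ofReal (hθ : 0 ≤ θ) (hr : 0 < r) (hκ : 0 ≤ re κ) (hκr : r ≤ ‖κ‖) :
    ∃ σ : 𝕜, starRingEnd 𝕜 σ * κ = θ ∧ ‖σ‖ ≤ θ / r ∧ 0 ≤ re σ := by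
  have hκ₀ : κ ≠ 0 := norm_pos_iff.1 (hr.trans_le hκr)
  refine ⟨θ / starRingEnd 𝕜 κ, ?_, ?_, ?_⟩
  · simp [hκ₀]
  · rw [norm_div, RCLike.norm_conj, RCLike.norm_ofReal, abs_of_nonneg hθ]
    gcongr
  · rw [div_eq_mul_inv, RCLike.re_ofReal_mul, RCLike.inv_re, RCLike.conj_re]
    exact mul_nonneg hθ (div_nonneg hκ (RCLike.normSq_nonneg _))

theorem le_re_inner_smul_add (hσκ : starRingEnd 𝕜 σ * κ = θ) (hσr : ‖σ‖ ≤ θ / r) (p w : V) :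
    θ * ‖w‖ ^ 2 - θ / r * ‖A‖ * (‖w‖ * ‖p‖) ≤ re ⟪σ • w, A p + κ • w⟫_𝕜 := by
  have hdiag : re ⟪σ • w, κ • w⟫_𝕜 = θ * ‖w‖ ^ 2 := by
    rw [inner_smul_left, inner_smul_right, ← mul_assoc, hσκ, inner_self_eq_norm_sq_to_K,
      ← RCLike.ofReal_pow, ← RCLike.ofReal_mul, RCLike.ofReal_re]
  have hcross : ‖σ • w‖ * ‖A p‖ ≤ (θ / r * ‖w‖) * (‖A‖ * ‖p‖) := by
    rw [norm_smul]
    have hθr := (norm_nonneg σ).trans hσr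
    exact mul_le_mul (by gcongr) (A.le_opNorm p) (norm_nonneg _) (by positivity)
  rw [inner_add_right, map_add, hdiag]
  linarith [neg_norm_mul_norm_le_re_inner (𝕜 := 𝕜) (σ • w) (A p)]

theorem neg_le_re_inner_conj_smul_add (hσκ : ‖σ‖ * ‖κ‖ = θ) (hσr : ‖σ‖ ≤ θ / r) (p : V) :
    -((θ + θ / r * ‖B‖) * ‖p‖ ^ 2) ≤ re ⟪(starRingEnd 𝕜 σ) • p, κ • p + B p⟫_𝕜 := by
  have hprod : ‖(starRingEnd 𝕜 σ) • p‖ * ‖κ • p + B p‖ ≤ (θ + θ / r * ‖B‖) * ‖p‖ ^ 2 := by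
    calc ‖(starRingEnd 𝕜 σ) • p‖ * ‖κ • p + B p‖
        ≤ (‖σ‖ * ‖p‖) * (‖κ‖ * ‖p‖ + ‖B‖ * ‖p‖) := by
          rw [norm_smul, RCLike.norm_conj]
          gcongr
          exact (norm_add_le _ _).trans (add_le_add (norm_smul_le _ _) (B.le_opNorm p))
      _ = (‖σ‖ * ‖κ‖ + ‖σ‖ * ‖B‖) * ‖p‖ ^ 2 := by ring
      _ ≤ (θ + θ / r * ‖B‖) * ‖p‖ ^ 2 := by rw [hσκ]; gcongr
  linarith [neg_norm_mul_norm_le_re_inner (𝕜 := 𝕜) ((starRingEnd 𝕜 σ) • p) (κ • p + B p)]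

theorem isStrictLyapunov_lyapOp_modeOp (hR : R.IsSymmetric) (hT : T.IsSymmetric)
    (hR₀ : ∀ u, 0 ≤ R.reApplyInnerSelf u) (hT₀ : ∀ z, 0 ≤ T.reApplyInnerSelf z)
    (hRAB : R ∘L (A + B) = .id 𝕜 V) (hTBA : T ∘L (B - A) = .id 𝕜 V) (hκ : 0 ≤ re κ)
    (hθ : 0 ≤ θ) (hθ₁ : θ * (1 + ‖B‖ / r + (‖A‖ / r) ^ 2) ≤ 1) (hr : 0 < r)
    (hσκ : starRingEnd 𝕜 σ * κ = θ) (hσr : ‖σ‖ ≤ θ / r) :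
    IsStrictLyapunov (lyapOp R T σ) (modeOp κ A B) (θ / 2) := by
  rintro ⟨p, w⟩
  rw [inner_lyapOp_modeOp, WithLp.prod_norm_sq_eq_of_L2, map_add, map_add, map_add]
  have hσκ_norm : ‖σ‖ * ‖κ‖ = θ := by
    rw [← RCLike.norm_conj σ, ← norm_mul, hσκ, RCLike.norm_ofReal, abs_of_nonneg hθ]
  have hu := re_inner_le_re_inner_inverse_add_smul hR hR₀ hRAB hκ (p + w) p
  have hz := re_inner_le_re_inner_inverse_add_smul hT hT₀ hTBA hκ (p - w) p
  have hw := le_re_inner_smul_add (A := A) hσκ hσr p w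
  have hp := neg_le_re_inner_conj_smul_add (B := B) hσκ_norm hσr p
  have huz : re ⟪p + w, p⟫_𝕜 + re ⟪p - w, p⟫_𝕜 = 2 * ‖p‖ ^ 2 := by
    rw [inner_add_left, inner_sub_left, map_add, map_sub, inner_self_eq_norm_sq]
    ring
  have hcross : θ / r * ‖A‖ * (‖w‖ * ‖p‖) ≤
      θ / 2 * ‖w‖ ^ 2 + θ / 2 * (‖A‖ / r) ^ 2 * ‖p‖ ^ 2 := by
    have := mul_nonneg hθ (sq_nonneg (‖w‖ - ‖A‖ / r * ‖p‖))
    linear_combination this / 2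
  have hcoeff : (θ + θ / r * ‖B‖ + θ / 2 * (‖A‖ / r) ^ 2) * ‖p‖ ^ 2 ≤ (2 - θ / 2) * ‖p‖ ^ 2 := by
    have hB : 0 ≤ θ * (‖B‖ / r) := by positivity
    have hA : 0 ≤ θ * (‖A‖ / r) ^ 2 := by positivity
    refine mul_le_mul_of_nonneg_right ?_ (sq_nonneg _)
    linear_combination (3 / 2) * hθ₁ + hB / 2 + hA
  simp only [WithLp.toLp_fst, WithLp.toLp_snd]
  linarith

end ModeLyapunov

section UniformDichotomy

variable {V : Type*} [NormedAddCommGroup V] [InnerProductSpace ℂ V] [FiniteDimensional ℂ V]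
  {R T A₀ B₀ : V →L[ℂ] V} {A B : ℝ → V →L[ℂ] V} {r θ ρ : ℝ} {κ : ℂ}

theorem hasDecayDichotomy_modeOp (hR : R.IsSymmetric) (hT : T.IsSymmetric)
    (hRpos : ∀ p, p ≠ 0 → 0 < R.reApplyInnerSelf p)
    (hTpos : ∀ p, p ≠ 0 → 0 < T.reApplyInnerSelf p)
    (hRAB : R ∘L (A₀ + B₀) = .id ℂ V) (hTBA : T ∘L (B₀ - A₀) = .id ℂ V) (hr : 0 < r)
    (hθ : 0 < θ) (hθ₁ : θ * (1 + ‖B₀‖ / r + (‖A₀‖ / r) ^ 2) ≤ 1)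
    (hρ : (4 * (‖R‖ + ‖T‖) + 2 * (θ / r)) * (2 * ρ) ≤ θ / 4) (hκ : 0 ≤ κ.re) (hκr : r ≤ ‖κ‖)
    (hA : Continuous A) (hB : Continuous B) (hAρ : ∀ x, ‖A x - A₀‖ ≤ ρ)
    (hBρ : ∀ x, ‖B x - B₀‖ ≤ ρ) :
    HasDecayDichotomy (fun x => modeOp κ (A x) (B x)) (Module.finrank ℂ V) := by
  obtain ⟨σ, hσκ, hσr, hσ⟩ := exists_conj_mul_eq_ofReal hθ.le hr hκ hκr
  have hnonneg {S : V →L[ℂ] V} (h : ∀ p, p ≠ 0 → 0 < S.reApplyInnerSelf p) (p : V) :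
      0 ≤ S.reApplyInnerSelf p := by
    rcases eq_or_ne p 0 with rfl | hp
    · simp [ContinuousLinearMap.reApplyInnerSelf_apply]
    · exact (h p hp).le
  have hL₀ := isStrictLyapunov_lyapOp_modeOp hR hT (hnonneg hRpos) (hnonneg hTpos) hRAB hTBA hκ
    hθ.le hθ₁ hr hσκ hσr
  have hdist (x : ℝ) : ‖modeOp κ (A x) (B x) - modeOp κ A₀ B₀‖ ≤ 2 * ρ :=
    (norm_modeOp_sub_le κ _ _ _ _).trans (by linarith [hAρ x, hBρ x])
  have hL (x : ℝ) : IsStrictLyapunov (lyapOp R T σ) (modeOp κ (A x) (B x)) (θ / 2 / 2) := by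
    refine hL₀.of_norm_sub_le ((mul_le_mul ?_ (hdist x) (norm_nonneg _) (by positivity)).trans
      (hρ.trans_eq (by ring)))
    exact (norm_lyapOp_le R T σ).trans (by linarith)
  have hK (x : ℝ) : ‖modeOp κ (A x) (B x)‖ ≤ ‖modeOp κ A₀ B₀‖ + 2 * ρ := by
    linarith [norm_sub_norm_le (modeOp κ (A x) (B x)) (modeOp κ A₀ B₀), hdist x]
  have hfin : Module.finrank ℂ (WithLp 2 (V × V)) = Module.finrank ℂ V + Module.finrank ℂ V :=
    (WithLp.linearEquiv 2 ℂ (V × V)).finrank_eq.trans Module.finrank_prod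
  have hneg (ξ : WithLp 2 (V × V)) (hξ : ξ ∈ scalarGraph V (-1 : ℂ)) (hne : ξ ≠ 0) :
      (lyapOp R T σ).reApplyInnerSelf ξ < 0 :=
    reApplyInnerSelf_lyapOp_neg_of_mem_scalarGraph hTpos hσ hξ hne
  have hpos (ξ : WithLp 2 (V × V)) (hξ : ξ ∈ scalarGraph V (1 : ℂ)) (hne : ξ ≠ 0) :
      0 < (lyapOp R T σ).reApplyInnerSelf ξ :=
    reApplyInnerSelf_lyapOp_pos_of_mem_scalarGraph hRpos hσ hξ hne
  exact hasDecayDichotomy_of_isStrictLyapunov (continuous_modeOp κ hA hB) hK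
    (isSymmetric_lyapOp hR hT σ) (by positivity) hL hneg hpos (finrank_scalarGraph _)
    (finrank_scalarGraph _) hfin

theorem exists_uniform_hasDecayDichotomy_modeOp (hR : R.IsSymmetric) (hT : T.IsSymmetric)
    (hRpos : ∀ p, p ≠ 0 → 0 < R.reApplyInnerSelf p)
    (hTpos : ∀ p, p ≠ 0 → 0 < T.reApplyInnerSelf p)
    (hRAB : R ∘L (A₀ + B₀) = .id ℂ V) (hTBA : T ∘L (B₀ - A₀) = .id ℂ V) (hr : 0 < r) :
    ∃ ρ > 0, ∀ κ : ℂ, 0 ≤ κ.re → r ≤ ‖κ‖ → ∀ A B : ℝ → V →L[ℂ] V, Continuous A →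
      Continuous B → (∀ x, ‖A x - A₀‖ ≤ ρ) → (∀ x, ‖B x - B₀‖ ≤ ρ) →
        HasDecayDichotomy (fun x => modeOp κ (A x) (B x)) (Module.finrank ℂ V) := by
  have hm : 0 < 1 + ‖B₀‖ / r + (‖A₀‖ / r) ^ 2 := by positivity
  obtain ⟨θ, hθ, hθ₁⟩ : ∃ θ > 0, θ * (1 + ‖B₀‖ / r + (‖A₀‖ / r) ^ 2) ≤ 1 :=
    ⟨_, inv_pos.2 hm, (inv_mul_cancel₀ hm.ne').le⟩
  have : 0 < 4 * (‖R‖ + ‖T‖) + 2 * (θ / r) := by positivity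
  refine ⟨θ / 8 / (4 * (‖R‖ + ‖T‖) + 2 * (θ / r)), by positivity, ?_⟩
  intro κ hκ hκr A B hA hB hAρ hBρ
  refine hasDecayDichotomy_modeOp hR hT hRpos hTpos hRAB hTBA hr hθ hθ₁ (Eq.le ?_) hκ hκr hA hB
    hAρ hBρ
  field_simp
  norm_num

end UniformDichotomy

section ComplexOp

variable {ι : Type*} [Fintype ι] [DecidableEq ι] {F : Matrix ι ι ℝ}

/-- The operator on `ℂ^ι` with a given real matrix. -/
def complexOp : Matrix ι ι ℝ →ₐ[ℝ] EuclideanSpace ℂ ι →L[ℂ] EuclideanSpace ℂ ι :=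
  ((Matrix.toEuclideanCLM (n := ι) (𝕜 := ℂ)).toAlgEquiv.toAlgHom.restrictScalars ℝ).comp
    Complex.ofRealAm.mapMatrix

theorem ofLp_complexOp_apply (F : Matrix ι ι ℝ) (p : EuclideanSpace ℂ ι) :
    (complexOp F p).ofLp = F.map Complex.ofReal *ᵥ p.ofLp :=
  rfl

theorem continuous_complexOp : Continuous (complexOp (ι := ι)) :=
  (complexOp (ι := ι)).toLinearMap.continuous_of_finiteDimensional

theorem isSymmetric_complexOp (hF : F.IsHermitian) : (complexOp F).IsSymmetric := by
  refine Matrix.isSymmetric_toEuclideanLin_iff.2 (hF.map _ fun x => ?_)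
  exact (Complex.conj_ofReal x).symm

theorem reApplyInnerSelf_complexOp (F : Matrix ι ι ℝ) (p : EuclideanSpace ℂ ι) :
    (complexOp F).reApplyInnerSelf p =
      (fun i => (p i).re) ⬝ᵥ F *ᵥ (fun i => (p i).re) +
        (fun i => (p i).im) ⬝ᵥ F *ᵥ (fun i => (p i).im) := by
  simp only [ContinuousLinearMap.reApplyInnerSelf_apply, PiLp.inner_apply, ofLp_complexOp_apply,
    Matrix.mulVec, dotProduct, Matrix.map_apply, RCLike.inner_apply, RCLike.re_to_complex,
    Complex.re_sum, Complex.mul_re, Complex.im_sum, Complex.mul_im, map_sum,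
    Complex.ofReal_re, Complex.ofReal_im, Complex.conj_re, Complex.conj_im,
    ← Finset.sum_add_distrib]
  refine Finset.sum_congr rfl fun i _ => ?_
  simp only [zero_mul, sub_zero, add_zero, mul_neg, Finset.sum_neg_distrib]
  ring

theorem reApplyInnerSelf_complexOp_pos (hF : F.PosDef) {p : EuclideanSpace ℂ ι} (hp : p ≠ 0) :
    0 < (complexOp F).reApplyInnerSelf p := by
  rw [reApplyInnerSelf_complexOp]
  have hre := hF.posSemidef.dotProduct_mulVec_nonneg fun i => (p i).re
  have him := hF.posSemidef.dotProduct_mulVec_nonneg fun i => (p i).im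
  by_cases hre₀ : (fun i => (p i).re) = 0
  · have him₀ : (fun i => (p i).im) ≠ 0 := fun him₀ =>
      hp (PiLp.ext fun i => Complex.ext (congrFun hre₀ i) (congrFun him₀ i))
    exact add_pos_of_nonneg_of_pos hre (hF.dotProduct_mulVec_pos him₀)
  · exact add_pos_of_pos_of_nonneg (hF.dotProduct_mulVec_pos hre₀) him

theorem complexOp_inv_comp_complexOp (hF : F.PosDef) :
    complexOp F⁻¹ ∘L complexOp F = .id ℂ (EuclideanSpace ℂ ι) := by
  rw [← ContinuousLinearMap.mul_def, ← map_mul,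
    Matrix.nonsing_inv_mul F (F.isUnit_iff_isUnit_det.1 hF.isUnit), map_one]
  rfl

end ComplexOp

section BoostedJacobian

variable {n : ℕ} {f g : Sp n → Sp n} {v : Sp n} {s : ℝ}

theorem abs_lt_one_of_mulVec_eq_smul_mulVec {ι : Type*} [Fintype ι] {F G : Matrix ι ι ℝ} {μ : ℝ}
    {r : ι → ℝ} (hr : r ≠ 0) (hμ : F *ᵥ r = μ • (G *ᵥ r))
    (hadd : (G + F).PosDef) (hsub : (G - F).PosDef) : |μ| < 1 := by
  have hadd_r := hadd.dotProduct_mulVec_pos hr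
  have hsub_r := hsub.dotProduct_mulVec_pos hr
  rw [Matrix.add_mulVec, hμ, dotProduct_add, dotProduct_smul, smul_eq_mul] at hadd_r
  rw [Matrix.sub_mulVec, hμ, dotProduct_sub, dotProduct_smul, smul_eq_mul] at hsub_r
  rw [abs_lt]
  constructor <;> nlinarith

theorem abs_charSpeed_lt_one {k : Fin n} {Ω : Set (Sp n)} (hA : StandingAssumptions k Ω f g) :
    |charSpeed f g k 0| < 1 := by
  have hspec : IsOrderedSpectrum (jac f 0) (jac g 0) (genEig (jac f 0) (jac g 0)) := by
    rw [genEig, dif_pos hA.simple]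
    exact hA.simple.choose_spec
  obtain ⟨r, hr, hμ⟩ := hspec.2 k
  exact abs_lt_one_of_mulVec_eq_smul_mulVec hr hμ hA.subchar_add hA.subchar_sub

theorem gam_pos (hs : |s| < 1) : 0 < gam s :=
  inv_pos.2 (Real.sqrt_pos.2 (sub_pos.2 ((sq_lt_one_iff_abs_lt_one s).2 hs)))

theorem continuousAt_gam (hs : |s| < 1) : ContinuousAt gam s :=
  ContinuousAt.inv₀ (by fun_prop) (inv_pos.1 (gam_pos hs)).ne'

theorem jac_boostF (hf : DifferentiableAt ℝ f v) (hg : DifferentiableAt ℝ g v) (s : ℝ) :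
    jac (boostF f g s) v = gam s • (jac f v - s • jac g v) := by
  have hderiv : HasFDerivAt (boostF f g s) (gam s • (fderiv ℝ f v - s • fderiv ℝ g v)) v :=
    (hf.hasFDerivAt.sub (hg.hasFDerivAt.const_smul s)).const_smul (gam s)
  ext i j
  simp [jac, hderiv.fderiv]

theorem jac_boostF_add_jac_boostG (hf : DifferentiableAt ℝ f v) (hg : DifferentiableAt ℝ g v)
    (s : ℝ) : jac (boostF f g s) v + jac (boostG f g s) v =
      (gam s * (1 - s)) • (jac g v + jac f v) := by
  rw [show boostG f g s = boostF g f s from rfl, jac_boostF hf hg, jac_boostF hg hf]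
  module

theorem jac_boostG_sub_jac_boostF (hf : DifferentiableAt ℝ f v) (hg : DifferentiableAt ℝ g v)
    (s : ℝ) : jac (boostG f g s) v - jac (boostF f g s) v =
      (gam s * (1 + s)) • (jac g v - jac f v) := by
  rw [show boostG f g s = boostF g f s from rfl, jac_boostF hf hg, jac_boostF hg hf]
  module

theorem continuousAt_jac (hf : ContDiffAt ℝ 1 f v) : ContinuousAt (jac f) v := by
  have hderiv : ContinuousAt (fderiv ℝ f) v := (hf.fderiv_right (m := 0) le_rfl).continuousAt
  refine continuousAt_pi.2 fun i => continuousAt_pi.2 fun j => ?_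
  exact (EuclideanSpace.proj (𝕜 := ℝ) i).continuous.continuousAt.comp
    (hderiv.clm_apply continuousAt_const)

theorem continuousAt_jac_boostF (hs : |s| < 1) (hf : ContDiffAt ℝ 1 f v)
    (hg : ContDiffAt ℝ 1 g v) :
    ContinuousAt (fun y : ℝ × Sp n => jac (boostF f g y.1) y.2) (s, v) := by
  have hformula : (fun y : ℝ × Sp n => jac (boostF f g y.1) y.2) =ᶠ[𝓝 (s, v)]
      fun y => gam y.1 • (jac f y.2 - y.1 • jac g y.2) := by
    filter_upwards [continuousAt_snd.eventually (hf.eventually (by simp)),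
      continuousAt_snd.eventually (hg.eventually (by simp))] with y hfy hgy
    exact jac_boostF (hfy.differentiableAt one_ne_zero) (hgy.differentiableAt one_ne_zero) y.1
  refine ContinuousAt.congr ?_ hformula.symm
  have hgam : ContinuousAt (fun y : ℝ × Sp n => gam y.1) (s, v) :=
    (continuousAt_gam hs).fst'
  exact hgam.smul ((continuousAt_jac hf).snd'.sub
    (continuousAt_fst.smul (continuousAt_jac hg).snd'))

end BoostedJacobian

section EvansBundles

variable {n : ℕ} {f g : Sp n → Sp n} {κ : ℂ} {s s₀ : ℝ} {v₀ : Sp n} {r : ℝ}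

/-- The coefficient matrix of the Laplace-mode system as an operator on the phase space. -/
def modeMatrixOp (f g : Sp n → Sp n) (s : ℝ) (κ : ℂ) (v : Sp n) : Ph n →L[ℂ] Ph n :=
  (modeMatrix f g s κ v).mulVecLin.toContinuousLinearMap

theorem decaySpace_eq_decayValues (f g : Sp n → Sp n) (s : ℝ) (κ : ℂ) (φ : ℝ → Sp n)
    (l : Filter ℝ) :
    decaySpace f g s κ φ l = decayValues (fun x => modeMatrixOp f g s κ (φ x)) l :=
  rfl

/-- The change of variables `(p, κ w) ↦ (p, w)`, after which `κ` enters the Laplace-mode system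
only linearly. -/
def rescalePhase (n : ℕ) (hκ : κ ≠ 0) :
    Ph n ≃ₗ[ℂ] WithLp 2 (EuclideanSpace ℂ (Fin n) × EuclideanSpace ℂ (Fin n)) where
  toFun ξ := WithLp.toLp 2 (WithLp.toLp 2 (ξ ∘ Sum.inl), WithLp.toLp 2 (κ⁻¹ • (ξ ∘ Sum.inr)))
  invFun η := Sum.elim η.fst.ofLp (κ • η.snd.ofLp)
  map_add' ξ η := by
    refine congrArg (WithLp.toLp 2) (Prod.ext ?_ ?_) <;> ext i <;> simp [mul_add]
  map_smul' c ξ := by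
    refine congrArg (WithLp.toLp 2) (Prod.ext ?_ ?_) <;> ext i <;> simp [mul_left_comm]
  left_inv ξ := by ext (i | i) <;> simp [hκ]
  right_inv η := by
    refine congrArg (WithLp.toLp 2) (Prod.ext ?_ ?_) <;> ext i <;> simp [hκ]

theorem rescalePhase_modeMatrixOp (hκ : κ ≠ 0) (v : Sp n) (ξ : Ph n) :
    rescalePhase n hκ (modeMatrixOp f g s κ v ξ) =
      modeOp κ (complexOp (jac (boostF f g s) v)) (complexOp (jac (boostG f g s) v))
        (rescalePhase n hκ ξ) := by
  refine congrArg (WithLp.toLp 2) (Prod.ext ?_ ?_) <;> ext i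
  · simp [rescalePhase, modeMatrixOp, modeMatrix, Matrix.fromBlocks_mulVec,
      ofLp_complexOp_apply, hκ]
  · simp [rescalePhase, modeMatrixOp, modeMatrix, Matrix.fromBlocks_mulVec,
      ofLp_complexOp_apply, Matrix.add_mulVec, Matrix.smul_mulVec]
    field_simp

theorem HasDecayDichotomy.of_rescalePhase (hκ : κ ≠ 0) {φ : ℝ → Sp n} {d : ℕ}
    (h : HasDecayDichotomy (fun x => modeOp κ (complexOp (jac (boostF f g s) (φ x)))
      (complexOp (jac (boostG f g s) (φ x)))) d) :
    HasDecayDichotomy (fun x => modeMatrixOp f g s κ (φ x)) d :=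
  h.map (rescalePhase n hκ).symm fun x η => by
    rw [LinearEquiv.symm_apply_eq, rescalePhase_modeMatrixOp, LinearEquiv.apply_symm_apply]

theorem exists_hasDecayDichotomy_modeOp_of_posDef {A₀ B₀ : Matrix (Fin n) (Fin n) ℝ}
    (hadd : (A₀ + B₀).PosDef) (hsub : (B₀ - A₀).PosDef) (hr : 0 < r) :
    ∃ ρ > 0, ∀ κ : ℂ, 0 ≤ κ.re → r ≤ ‖κ‖ → ∀ A B : ℝ → Matrix (Fin n) (Fin n) ℝ,
      Continuous A → Continuous B → (∀ x, ‖complexOp (A x) - complexOp A₀‖ ≤ ρ) →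
      (∀ x, ‖complexOp (B x) - complexOp B₀‖ ≤ ρ) →
      HasDecayDichotomy (fun x => modeOp κ (complexOp (A x)) (complexOp (B x))) n := by
  obtain ⟨ρ, hρ, hdich⟩ := exists_uniform_hasDecayDichotomy_modeOp
    (isSymmetric_complexOp hadd.inv.isHermitian) (isSymmetric_complexOp hsub.inv.isHermitian)
    (fun p => reApplyInnerSelf_complexOp_pos hadd.inv)
    (fun p => reApplyInnerSelf_complexOp_pos hsub.inv)
    (by rw [← map_add complexOp]; exact complexOp_inv_comp_complexOp hadd)
    (by rw [← map_sub complexOp]; exact complexOp_inv_comp_complexOp hsub) hr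
  rw [finrank_euclideanSpace_fin] at hdich
  exact ⟨ρ, hρ, fun κ hκ hκr A B hA hB hA₀ hB₀ => hdich κ hκ hκr _ _
    (continuous_complexOp.comp hA) (continuous_complexOp.comp hB) hA₀ hB₀⟩

theorem posDef_jac_boostF_add_jac_boostG (hs : |s| < 1) (hf : DifferentiableAt ℝ f v₀)
    (hg : DifferentiableAt ℝ g v₀) (hadd : (jac g v₀ + jac f v₀).PosDef) :
    (jac (boostF f g s) v₀ + jac (boostG f g s) v₀).PosDef := by
  rw [jac_boostF_add_jac_boostG hf hg]
  exact hadd.smul (mul_pos (gam_pos hs) (by linarith [(abs_lt.1 hs).2]))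

theorem posDef_jac_boostG_sub_jac_boostF (hs : |s| < 1) (hf : DifferentiableAt ℝ f v₀)
    (hg : DifferentiableAt ℝ g v₀) (hsub : (jac g v₀ - jac f v₀).PosDef) :
    (jac (boostG f g s) v₀ - jac (boostF f g s) v₀).PosDef := by
  rw [jac_boostG_sub_jac_boostF hf hg]
  exact hsub.smul (mul_pos (gam_pos hs) (by linarith [(abs_lt.1 hs).1]))

theorem exists_nhds_hasDecayDichotomy_modeMatrixOp (hs₀ : |s₀| < 1) (hf : ContDiffAt ℝ 1 f v₀)
    (hg : ContDiffAt ℝ 1 g v₀) (hadd : (jac g v₀ + jac f v₀).PosDef)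
    (hsub : (jac g v₀ - jac f v₀).PosDef) (hr : 0 < r) :
    ∃ U ∈ 𝓝 (s₀, v₀), ∀ (s : ℝ) (φ : ℝ → Sp n), Continuous φ → (∀ x, (s, φ x) ∈ U) →
      ∀ κ : ℂ, 0 ≤ κ.re → r ≤ ‖κ‖ →
        HasDecayDichotomy (fun x => modeMatrixOp f g s κ (φ x)) n := by
  let A (y : ℝ × Sp n) := jac (boostF f g y.1) y.2
  let B (y : ℝ × Sp n) := jac (boostG f g y.1) y.2
  have hreg : ∀ᶠ y in 𝓝 (s₀, v₀), ContinuousAt A y ∧ ContinuousAt B y := by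
    filter_upwards [(continuous_fst.abs.tendsto _).eventually_lt_const hs₀,
      (continuous_snd.tendsto _).eventually (hf.eventually (by simp)),
      (continuous_snd.tendsto _).eventually (hg.eventually (by simp))] with y hy hfy hgy
    exact ⟨continuousAt_jac_boostF hy hfy hgy, continuousAt_jac_boostF hy hgy hfy⟩
  obtain ⟨ρ, hρ, hdich⟩ := exists_hasDecayDichotomy_modeOp_of_posDef
    (posDef_jac_boostF_add_jac_boostG hs₀ (hf.differentiableAt one_ne_zero)
      (hg.differentiableAt one_ne_zero) hadd)
    (posDef_jac_boostG_sub_jac_boostF hs₀ (hf.differentiableAt one_ne_zero)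
      (hg.differentiableAt one_ne_zero) hsub) hr
  have hnear {D : ℝ × Sp n → Matrix (Fin n) (Fin n) ℝ} (hD : ContinuousAt D (s₀, v₀)) :
      ∀ᶠ y in 𝓝 (s₀, v₀), ‖complexOp (D y) - complexOp (D (s₀, v₀))‖ ≤ ρ := by
    filter_upwards [(continuous_complexOp.continuousAt.comp hD).eventually
      (Metric.closedBall_mem_nhds _ hρ)] with y hy
    exact mem_closedBall_iff_norm.1 hy
  refine ⟨_, hreg.and ((hnear hreg.self_of_nhds.1).and (hnear hreg.self_of_nhds.2)),
    fun s φ hφ hmem κ hκ hκr => ?_⟩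
  have hcont {D : ℝ × Sp n → Matrix (Fin n) (Fin n) ℝ} (hD : ∀ x, ContinuousAt D (s, φ x)) :
      Continuous fun x => D (s, φ x) := continuous_iff_continuousAt.2 fun x =>
    (hD x).comp (f := fun x => (s, φ x)) (continuousAt_const.prodMk hφ.continuousAt)
  exact .of_rescalePhase (norm_pos_iff.1 (hr.trans_le hκr))
    (hdich κ hκ hκr _ _ (hcont fun x => (hmem x).1.1) (hcont fun x => (hmem x).1.2)
      (fun x => (hmem x).2.1) fun x => (hmem x).2.2)

end EvansBundles

end HypReg

end

theorem mainTheorem6_general {n : ℕ} {f g : HypReg.Sp n → HypReg.Sp n}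
    (hf : ContDiffAt ℝ 1 f 0) (hg : ContDiffAt ℝ 1 g 0)
    (hadd : (HypReg.jac g 0 + HypReg.jac f 0).PosDef)
    (hsub : (HypReg.jac g 0 - HypReg.jac f 0).PosDef)
    {s : ℝ → ℝ} {s₀ : ℝ} (hs : Tendsto s (𝓝[>] 0) (𝓝 s₀)) (hs₀ : |s₀| < 1)
    {ε₁ : ℝ} (hε₁ : 0 < ε₁) {r₁ : ℝ} (hr₁ : 0 < r₁) (C : ℝ) :
    ∃ ε₀ ∈ Set.Ioc 0 ε₁, ∀ ε ∈ Set.Ioc 0 ε₀, ∀ φ : ℝ → HypReg.Sp n,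
      Continuous φ → (∀ x, ‖φ x‖ ≤ C * ε) →
      ∀ ζ : ℂ, 0 ≤ ζ.re → r₁ ≤ ε ^ 2 * ‖ζ‖ →
        Module.finrank ℂ (HypReg.rescaledEvansMinus f g (s ε) φ ε ζ) = n ∧
        Module.finrank ℂ (HypReg.rescaledEvansPlus f g (s ε) φ ε ζ) = n ∧
        HypReg.rescaledEvansMinus f g (s ε) φ ε ζ ⊓
          HypReg.rescaledEvansPlus f g (s ε) φ ε ζ = ⊥ := by
  obtain ⟨U, hU, hdich⟩ :=
    HypReg.exists_nhds_hasDecayDichotomy_modeMatrixOp hs₀ hf hg hadd hsub hr₁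
  obtain ⟨V, hV, W, hW, hVW⟩ := mem_nhds_prod_iff.1 hU
  obtain ⟨d, hd, hdW⟩ := Metric.nhds_basis_closedBall.mem_iff.1 hW
  have hsmall : ∀ᶠ ε in 𝓝[>] (0 : ℝ), C * ε ≤ d :=
    nhdsWithin_le_nhds <| (tendsto_const_nhds.mul tendsto_id).eventually_le_const <| by simpa
  obtain ⟨ε₀, hε₀, hε⟩ :=
    (mem_nhdsGT_iff_exists_mem_Ioc_Ioo_subset hε₁).1 ((hs.eventually hV).and hsmall)
  refine ⟨ε₀ / 2, ⟨half_pos hε₀.1, (half_le_self hε₀.1.le).trans hε₀.2⟩,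
    fun ε hεpos φ hφ hbound ζ hζ hζr => ?_⟩
  obtain ⟨hsε, hCε⟩ := hε ⟨hεpos.1, hεpos.2.trans_lt (half_lt_self hε₀.1)⟩
  simp only [HypReg.rescaledEvansMinus, HypReg.rescaledEvansPlus, HypReg.evansMinus,
    HypReg.evansPlus, HypReg.decaySpace_eq_decayValues]
  refine hdich (s ε) φ hφ (fun x => hVW ⟨hsε, hdW ?_⟩) ((ε : ℂ) ^ 2 * ζ) ?_ ?_
  · exact mem_closedBall_zero_iff.2 ((hbound x).trans hCε)
  · rw [← Complex.ofReal_pow, Complex.re_ofReal_mul]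
    positivity
  · rwa [norm_mul, norm_pow, Complex.norm_real, Real.norm_of_nonneg hεpos.1.le]

theorem mainTheorem6 {n : ℕ} (k : Fin n) (hk : k.val = 0 ∨ k.val + 1 = n)
    (Ω : Set (HypReg.Sp n)) (hΩ : IsOpen Ω) (h0 : (0 : HypReg.Sp n) ∈ Ω)
    (f g : HypReg.Sp n → HypReg.Sp n)
    (hf : ContDiffOn ℝ ∞ f Ω) (hg : ContDiffOn ℝ ∞ g Ω)
    (hA : HypReg.StandingAssumptions k Ω f g) (hN : HypReg.NormalCoordinates k f g)
    (ε₁ : ℝ) (hε₁ : 0 < ε₁) (hε₁' : ε₁ ≤ 1)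
    (vm vp : ℝ → HypReg.Sp n) (s : ℝ → ℝ)
    (hS : HypReg.IsShockFamily k Ω f g ε₁ vm vp s)
    (r₁ : ℝ) (hr₁ : 0 < r₁) :
    ∃ ε₀ ∈ Set.Ioc 0 ε₁, ∀ ε ∈ Set.Ioc 0 ε₀, ∀ φ : ℝ → HypReg.Sp n,
      HypReg.IsShockProfile Ω f g (vm ε) (vp ε) (s ε) φ → (∀ x, ‖φ x‖ ≤ 3 * ε) →
      ∀ ζ : ℂ, 0 ≤ ζ.re → r₁ ≤ ε ^ 2 * ‖ζ‖ →
        Module.finrank ℂ (HypReg.rescaledEvansMinus f g (s ε) φ ε ζ) = n ∧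
        Module.finrank ℂ (HypReg.rescaledEvansPlus f g (s ε) φ ε ζ) = n ∧
        HypReg.rescaledEvansMinus f g (s ε) φ ε ζ ⊓
          HypReg.rescaledEvansPlus f g (s ε) φ ε ζ = ⊥ := by
  have hf₀ := (hf.contDiffAt (hΩ.mem_nhds h0)).of_le (m := 1) (by simp)
  have hg₀ := (hg.contDiffAt (hΩ.mem_nhds h0)).of_le (m := 1) (by simp)
  have hspeed : Tendsto s (𝓝[>] 0) (𝓝 (HypReg.charSpeed f g k 0)) := by
    rw [← hS.speed_zero, ← nhdsWithin_Ioc_eq_nhdsGT hε₁]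
    exact (hS.smooth_s.continuousOn 0 (left_mem_Icc.2 hε₁.le)).mono_left
      (nhdsWithin_mono 0 Ioc_subset_Icc_self)
  obtain ⟨ε₀, hε₀, hdich⟩ := mainTheorem6_general hf₀ hg₀ hA.subchar_add hA.subchar_sub hspeed
    (HypReg.abs_charSpeed_lt_one hA) hε₁ hr₁ 3
  exact ⟨ε₀, hε₀, fun ε hε φ hφ => hdich ε hε φ hφ.smooth.continuous⟩
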